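/- Let $K$ be a commutative ring. For polynomials over $K$ put $\mathrm{MP}(F,G)=(FG \operatorname{div} X^{n-1})\bmod X^m$ for $F$ of size $m+n-1$ and $G$ of size $n$ (middle product in size $(m+n-1,n)$), and $\mathrm{SP}(F,G)=FG\bmod X^n$ for $F,G$ of size $n$ (short product), where size $n$ means degree $\le n-1$; $F_{[a..b[}$ is the chunk $f_a+f_{a+1}X+\dots+f_{b-1}X^{b-a-1}$ of $F$, and also the registers that hold it. Computational model. Registers hold elements of $K$ or pointers and sizes (non-negative integers not exceeding the end of the address space). The input is read-only, the output is pre-allocated and may be read and written. Time is the number of operations in $K$ (addition, subtraction, negation, multiplication, inversion); pointer arithmetic, control and copying are free, and control does not depend on the values of the coefficients. Extra space is the number of registers used besides input and output. Let $M:\mathbb N\to\mathbb R_{\ge 0}$ satisfy $\alpha M(n)\le M(\alpha n)$ for all real $\alpha\ge1$ and all integers $n\ge 1$ with $\alpha n$ an integer ($M(n)$ is a bound for multiplication in size $n$). Let real constants $\lambda_m,\lambda_s,c_m,c_s\ge0$ be given, together with a procedure for $\mathrm{MP}$ in size $(2n-1,n)$ that uses at most $\lambda_mM(n)$ operations in $K$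 and at most $c_mn+O(1)$ extra registers, and a procedure for $\mathrm{SP}$ in size $n$ that uses at most $\lambda_sM(n)$ operations and at most $c_sn+O(1)$ extra registers, where $c_mn$ (respectively $c_sn$) of the registers are a work space supplied by the caller. A middle product in size $(k+\ell-1,k)$, $1\le\ell\le k$, is computed by cutting the second factor into $\lceil k/\ell\rceil$ pieces of size at most $\ell$ (one of them padded by zeros) and adding up $\lceil k/\ell\rceil$ middle products in size $(2\ell-1,\ell)$. Put $c=2+\max(c_m,c_s)$. Algorithm InPlaceInv. Input: $F$ of size $n\ge1$ with $F_{[0]}$ invertible. Output: $G$ of size $n$. 1. $G_{[0]}\gets F_{[0]}^{-1}$, $\;k\gets1$, $\;\ell\gets\min(k,\lfloor (n-k)/c\rfloor)$. 2. While $\ell>0$: $G_{[n-\ell..n[}\gets \mathrm{MP}(F_{[1..k+\ell[},G_{[0..k[})$ with work space $G_{[k..n-\ell[}$; $\;G_{[k..k+\ell[}\gets\mathrm{SP}(G_{[0..\ell[},-G_{[n-\ell..n[})$ with work space $G_{[k+\ell..n-\ell[}$; $\;k\gets k+\ell$; $\;\ell\gets\min(k,\lfloor (n-k)/c\rfloor)$.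 3. While $k<n$: $\ell\gets\min(k,n-k)$; $\;G_{[k..k+\ell[}\gets\mathrm{SP}(G_{[0..\ell[},-\mathrm{MP}(F_{[1..k+\ell[},G_{[0..k[}))$, with $O(1)$ extra registers as work space; $\;k\gets k+\ell$. (For $n\ge 2c$ this is a single step, with $\ell=n-k$.) Theorem. For every $n\ge1$, step 2 consists of an accelerating phase of Newton steps with $\ell=k$ (possibly empty), followed by a decelerating phase in which always $\ell<k$. The algorithm is correct, that is, $FG\equiv1 \pmod{X^n}$ for every $n\ge 1$ and every input $F$ of size $n$ with $F_{[0]}$ invertible. It uses $O(1)$ extra space. The number of operations in $K$ that it uses is at most $T(n)$ for all inputs of size $n$, where $T$ satisfies the following as $n\to\infty$. (i) If $M$ is quasi-linear, meaning here that $M(n)=O(n(\log n)^{\kappa})$ for some $\kappa\in\mathbb N$ and $n\log n=O(M(n))$, then $$T(n)\le\lambda_mM(n)\log_{\frac{c}{c-1}}(n)+O(M(n)),$$ and in particular, if $c_s\le c_m$ (for example for an in-place short product, $c_s=0$), so that $c=c_m+2$, $$T(n)\le\lambda_mM(n)\log_{\frac{c_m+2}{c_m+1}}(n)+O(M(n)).$$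 (ii) If $M(n)=n^{1+\gamma}$ for all $n\ge1$, with $0<\gamma\le1$, then $T(n)=O(M(n))$. -/

import Mathlib

open Polynomial Asymptotics Filter

universe u

/-! ### A register machine over a coefficient ring

The memory `m : ℕ → K` consists of cells that hold elements of the coefficient ring `K`.
A procedure has in addition a fixed number `r` of index registers, which hold pointers (addresses)
and sizes; they are counted as space.  Computing with indices (addresses, loop conditions) is not
an operation in `K` and is free; index values never depend on ring elements.  -/

/-- Index expressions over `r` index registers. -/
abbrev IdxExpr (r : ℕ) : Type := (Fin r → ℕ) → ℕ

/-- The binary ring operations of the machine. -/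
inductive ArithOp : Type
  | add
  | sub
  | mul

/-- The meaning of a binary ring operation. -/
def ArithOp.eval {K : Type u} [CommRing K] : ArithOp → K → K → K
  | .add, x, y => x + y
  | .sub, x, y => x - y
  | .mul, x, y => x * y

/-- Commands of a procedure with `r` index registers.  An address is given by an index expression,
and the first argument of every command on the memory is the destination. -/
inductive Cmd (K : Type u) : ℕ → Type u
  /-- assign a value to an index register -/
  | set {r : ℕ} (x : Fin r) (e : IdxExpr r) : Cmd K r
  /-- write a constant of `K`; it may depend on indices (e.g. a root of unity of a given order) -/
  | const {r : ℕ} (dst : IdxExpr r) (val : (Fin r → ℕ) → K) : Cmd K r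
  /-- copy a cell -/
  | copy {r : ℕ} (dst src : IdxExpr r) : Cmd K r
  /-- add, subtract or multiply the contents of two cells -/
  | arith {r : ℕ} (op : ArithOp) (dst src₁ src₂ : IdxExpr r) : Cmd K r
  /-- negate the content of a cell -/
  | neg {r : ℕ} (dst src : IdxExpr r) : Cmd K r
  /-- invert the content of a cell -/
  | inv {r : ℕ} (dst src : IdxExpr r) : Cmd K r
  /-- sequential composition -/
  | seq {r : ℕ} (p q : Cmd K r) : Cmd K r
  /-- branch on a condition on the indices -/
  | cond {r : ℕ} (b : (Fin r → ℕ) → Prop) (p q : Cmd K r) : Cmd K r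
  /-- while loop, controlled by a condition on the indices -/
  | loop {r : ℕ} (b : (Fin r → ℕ) → Prop) (p : Cmd K r) : Cmd K r
  /-- call a procedure, with `s` index registers of its own, on a list of index arguments -/
  | call {r s : ℕ} (body : Cmd K s) (args : List (IdxExpr r)) : Cmd K r

/-- sequential composition -/
infixr:60 " ;; " => Cmd.seq

/-- The initial index registers of a procedure: the arguments, followed by zeros. -/
def frame (s : ℕ) (args : List ℕ) : Fin s → ℕ := fun i => args.getD i 0

/-- The largest number of index registers that are alive at the same time (the registers of the
caller stay alive during a call). -/
def Cmd.regs {K : Type u} : {r : ℕ} → Cmd K r → ℕ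
  | r, .set _ _ => r
  | r, .const _ _ => r
  | r, .copy _ _ => r
  | r, .arith _ _ _ _ => r
  | r, .neg _ _ => r
  | r, .inv _ _ => r
  | _, .seq p q => max p.regs q.regs
  | _, .cond _ p q => max p.regs q.regs
  | _, .loop _ p => p.regs
  | r, .call body _ => r + body.regs

/-- Big-step semantics.  `Exec B W p ρ m ρ' m' t` : the command `p`, started with index registers
`ρ` and memory `m`, terminates with `ρ'` and `m'` after exactly `t` operations in `K`, it writes
only to cells in the set `W` (all other cells are read-only throughout the execution), and every
value put into an index register is at most `B`, the end of the address space. -/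
inductive Exec {K : Type u} [CommRing K] (B : ℕ) (W : Set ℕ) :
    {r : ℕ} → Cmd K r → (Fin r → ℕ) → (ℕ → K) → (Fin r → ℕ) → (ℕ → K) → ℕ → Prop
  | set {r : ℕ} {x : Fin r} {e : IdxExpr r} {ρ : Fin r → ℕ} {m : ℕ → K} (h : e ρ ≤ B) :
      Exec B W (.set x e) ρ m (Function.update ρ x (e ρ)) m 0
  | const {r : ℕ} {dst : IdxExpr r} {val : (Fin r → ℕ) → K} {ρ : Fin r → ℕ} {m : ℕ → K}
      (h : dst ρ ∈ W) :
      Exec B W (.const dst val) ρ m ρ (Function.update m (dst ρ) (val ρ)) 0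
  | copy {r : ℕ} {dst src : IdxExpr r} {ρ : Fin r → ℕ} {m : ℕ → K} (h : dst ρ ∈ W) :
      Exec B W (.copy dst src) ρ m ρ (Function.update m (dst ρ) (m (src ρ))) 0
  | arith {r : ℕ} {op : ArithOp} {dst src₁ src₂ : IdxExpr r} {ρ : Fin r → ℕ} {m : ℕ → K}
      (h : dst ρ ∈ W) :
      Exec B W (.arith op dst src₁ src₂) ρ m ρ
        (Function.update m (dst ρ) (op.eval (m (src₁ ρ)) (m (src₂ ρ)))) 1
  | neg {r : ℕ} {dst src : IdxExpr r} {ρ : Fin r → ℕ} {m : ℕ → K} (h : dst ρ ∈ W) :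
      Exec B W (.neg dst src) ρ m ρ (Function.update m (dst ρ) (-m (src ρ))) 1
  | inv {r : ℕ} {dst src : IdxExpr r} {ρ : Fin r → ℕ} {m : ℕ → K} {y : K} (h : dst ρ ∈ W)
      (hy : m (src ρ) * y = 1) :
      Exec B W (.inv dst src) ρ m ρ (Function.update m (dst ρ) y) 1
  | seq {r : ℕ} {p q : Cmd K r} {ρ ρ₁ ρ₂ : Fin r → ℕ} {m m₁ m₂ : ℕ → K} {t₁ t₂ : ℕ}
      (hp : Exec B W p ρ m ρ₁ m₁ t₁) (hq : Exec B W q ρ₁ m₁ ρ₂ m₂ t₂) :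
      Exec B W (.seq p q) ρ m ρ₂ m₂ (t₁ + t₂)
  | cond_true {r : ℕ} {b : (Fin r → ℕ) → Prop} {p q : Cmd K r} {ρ ρ₁ : Fin r → ℕ}
      {m m₁ : ℕ → K} {t : ℕ} (h : b ρ) (hp : Exec B W p ρ m ρ₁ m₁ t) :
      Exec B W (.cond b p q) ρ m ρ₁ m₁ t
  | cond_false {r : ℕ} {b : (Fin r → ℕ) → Prop} {p q : Cmd K r} {ρ ρ₁ : Fin r → ℕ}
      {m m₁ : ℕ → K} {t : ℕ} (h : ¬ b ρ) (hq : Exec B W q ρ m ρ₁ m₁ t) :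
      Exec B W (.cond b p q) ρ m ρ₁ m₁ t
  | loop_done {r : ℕ} {b : (Fin r → ℕ) → Prop} {p : Cmd K r} {ρ : Fin r → ℕ} {m : ℕ → K}
      (h : ¬ b ρ) : Exec B W (.loop b p) ρ m ρ m 0
  | loop_step {r : ℕ} {b : (Fin r → ℕ) → Prop} {p : Cmd K r} {ρ ρ₁ ρ₂ : Fin r → ℕ}
      {m m₁ m₂ : ℕ → K} {t₁ t₂ : ℕ} (h : b ρ) (hp : Exec B W p ρ m ρ₁ m₁ t₁)
      (hl : Exec B W (.loop b p) ρ₁ m₁ ρ₂ m₂ t₂) :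
      Exec B W (.loop b p) ρ m ρ₂ m₂ (t₁ + t₂)
  | call {r s : ℕ} {body : Cmd K s} {args : List (IdxExpr r)} {ρ : Fin r → ℕ}
      {ρ₁ : Fin s → ℕ} {m m₁ : ℕ → K} {t : ℕ} (h : ∀ e ∈ args, e ρ ≤ B)
      (hb : Exec B W body (frame s (args.map fun e => e ρ)) m ρ₁ m₁ t) :
      Exec B W (.call body args) ρ m ρ m₁ t

/-- A procedure: a number of index registers and a body. -/
structure Proc (K : Type u) where
  /-- number of index registers of the body -/
  size : ℕ
  /-- the code -/
  body : Cmd K size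

/-- `for j = 0, …, bound - 1 do body` (`body` must not change `j` or `bound`). -/
def Cmd.for {K : Type u} {r : ℕ} (j : Fin r) (bound : IdxExpr r) (body : Cmd K r) : Cmd K r :=
  .set j (fun _ => 0) ;;
  .loop (fun ρ => ρ j < bound ρ) (body ;; .set j (fun ρ => ρ j + 1))

/-! ### Polynomials in memory, middle product and short product -/

/-- The block of the `n` cells with addresses `a, …, a + n - 1`. -/
def block (a n : ℕ) : Set ℕ := Set.Ico a (a + n)

/-- The size-`n` polynomial whose coefficients are stored in `block a n`. -/
noncomputable def polyAt {K : Type u} [CommRing K] (m : ℕ → K) (a n : ℕ) : K[X] :=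
  ∑ i ∈ Finset.range n, C (m (a + i)) * X ^ i

/-- The middle product of `F` of size `m + n - 1` and `G` of size `n`:
`(F G div X ^ (n - 1)) mod X ^ m`. -/
noncomputable def middleProduct {K : Type u} [CommRing K] (m n : ℕ) (F G : K[X]) : K[X] :=
  ((F * G) /ₘ X ^ (n - 1)) %ₘ X ^ m

/-- The short product of two polynomials of size `n`: `F G mod X ^ n`. -/
noncomputable def shortProduct {K : Type u} [CommRing K] (n : ℕ) (F G : K[X]) : K[X] :=
  (F * G) %ₘ X ^ n

/-- `P` is an algorithm for the middle product in size `(2n - 1, n)`, for every `n ≥ 1`, that uses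
at most `T n` operations in `K`, a work space of at most `c n` cells, and `d` further cells.
Its arguments are `n`, the addresses `a`, `b` of the two (read-only) input polynomials, the address
`o` of the output, the address `w` of the work space and the address `e` of the further cells. -/
def Proc.IsMiddleProduct {K : Type u} [CommRing K] (P : Proc K) (T : ℕ → ℝ) (c : ℝ) (d : ℕ) :
    Prop :=
  ∀ (n B a b o w e : ℕ) (m : ℕ → K), 1 ≤ n →
    a + (2 * n - 1) ≤ B → b + n ≤ B → o + n ≤ B → w + ⌊c * n⌋₊ ≤ B → e + d ≤ B →
    Disjoint (block o n) (block w ⌊c * n⌋₊) → Disjoint (block o n) (block e d) →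
    Disjoint (block w ⌊c * n⌋₊) (block e d) →
    Disjoint (block a (2 * n - 1)) (block o n ∪ block w ⌊c * n⌋₊ ∪ block e d) →
    Disjoint (block b n) (block o n ∪ block w ⌊c * n⌋₊ ∪ block e d) →
    ∃ (ρ' : Fin P.size → ℕ) (m' : ℕ → K) (t : ℕ),
      Exec B (block o n ∪ block w ⌊c * n⌋₊ ∪ block e d) P.body
        (frame P.size [n, a, b, o, w, e]) m ρ' m' t ∧
      polyAt m' o n = middleProduct n n (polyAt m a (2 * n - 1)) (polyAt m b n) ∧
      (t : ℝ) ≤ T n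

/-- `P` is an algorithm for the short product in size `n`, for every `n ≥ 1`, that uses at most
`T n` operations in `K`, a work space of at most `c n` cells, and `d` further cells; the arguments
are as for the middle product. -/
def Proc.IsShortProduct {K : Type u} [CommRing K] (P : Proc K) (T : ℕ → ℝ) (c : ℝ) (d : ℕ) :
    Prop :=
  ∀ (n B a b o w e : ℕ) (m : ℕ → K), 1 ≤ n →
    a + n ≤ B → b + n ≤ B → o + n ≤ B → w + ⌊c * n⌋₊ ≤ B → e + d ≤ B →
    Disjoint (block o n) (block w ⌊c * n⌋₊) → Disjoint (block o n) (block e d) →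
    Disjoint (block w ⌊c * n⌋₊) (block e d) →
    Disjoint (block a n) (block o n ∪ block w ⌊c * n⌋₊ ∪ block e d) →
    Disjoint (block b n) (block o n ∪ block w ⌊c * n⌋₊ ∪ block e d) →
    ∃ (ρ' : Fin P.size → ℕ) (m' : ℕ → K) (t : ℕ),
      Exec B (block o n ∪ block w ⌊c * n⌋₊ ∪ block e d) P.body
        (frame P.size [n, a, b, o, w, e]) m ρ' m' t ∧
      polyAt m' o n = shortProduct n (polyAt m a n) (polyAt m b n) ∧
      (t : ℝ) ≤ T n

/-- `P` inverts power series at precision `n` with extra space at most `S` and at most `τ`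
operations in `K`.  Its arguments are `n`, the address `p` of the (read-only) input `F` of size `n`,
whose constant coefficient is invertible, the address `q` of the output `G` of size `n`, and the
address `e` of the extra cells.  Apart from the output, it may only write to `s` extra cells, where
`s` together with the number of its index registers is at most `S`. -/
def Proc.InvertsWithin {K : Type u} [CommRing K] (P : Proc K) (S n : ℕ) (τ : ℝ) : Prop :=
  ∃ s : ℕ, s + P.body.regs ≤ S ∧
    ∀ (B p q e : ℕ) (m : ℕ → K), p + n ≤ B → q + n ≤ B → e + s ≤ B →
      Disjoint (block q n) (block e s) →
      Disjoint (block p n) (block q n ∪ block e s) →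
      IsUnit (m p) →
      ∃ (ρ' : Fin P.size → ℕ) (m' : ℕ → K) (t : ℕ),
        Exec B (block q n ∪ block e s) P.body (frame P.size [n, p, q, e]) m ρ' m' t ∧
        X ^ n ∣ polyAt m p n * polyAt m' q n - 1 ∧
        (t : ℝ) ≤ τ

/-! ### The in-place inversion algorithm -/

/-- The middle product in size `(k + ℓ - 1, k)`, `1 ≤ ℓ ≤ k`, by `⌈k/ℓ⌉` middle products in size
`(2ℓ - 1, ℓ)`.  Index registers (the first eight are arguments): `0 : k`, `1 : ℓ`, `2 : f` (address
of `F`), `3 : g` (address of `G`), `4 : R` (address of the result), `5 : T` (address of `ℓ` auxiliary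
cells), `6 : w` (work space of `MP`), `7 : e` (further cells of `MP`), `8 : s`, `9 : j`.
The polynomial `G` is cut into a first piece of size `s = k - (⌈k/ℓ⌉ - 1) ℓ`, which is padded by
zeros, and pieces of size `ℓ`. -/
def unbalancedMP {K : Type u} [CommRing K] (MP : Proc K) : Cmd K 10 :=
  .set 8 (fun ρ => ρ 0 - (ρ 0 - 1) / ρ 1 * ρ 1) ;;
  .for 9 (fun ρ => ρ 1)
    (.cond (fun ρ => ρ 9 < ρ 8)
      (.copy (fun ρ => ρ 5 + ρ 9) (fun ρ => ρ 3 + ρ 9))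
      (.const (fun ρ => ρ 5 + ρ 9) (fun _ => 0))) ;;
  .call MP.body [fun ρ => ρ 1, fun ρ => ρ 2 + (ρ 0 - ρ 1), fun ρ => ρ 5, fun ρ => ρ 4,
    fun ρ => ρ 6, fun ρ => ρ 7] ;;
  .loop (fun ρ => ρ 8 < ρ 0)
    (.call MP.body [fun ρ => ρ 1, fun ρ => ρ 2 + (ρ 0 - ρ 8 - ρ 1), fun ρ => ρ 3 + ρ 8,
        fun ρ => ρ 5, fun ρ => ρ 6, fun ρ => ρ 7] ;;
      .for 9 (fun ρ => ρ 1)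
        (.arith .add (fun ρ => ρ 4 + ρ 9) (fun ρ => ρ 4 + ρ 9) (fun ρ => ρ 5 + ρ 9)) ;;
      .set 8 (fun ρ => ρ 8 + ρ 1))

/-- One generalized Newton step
`G_[k..k+ℓ[ ← SP(G_[0..ℓ[, -MP(F_[1..k+ℓ[, G_[0..k[))`.
Index registers (the first eight are arguments): `0 : p` (address of `F`), `1 : q` (address of `G`),
`2 : k`, `3 : ℓ`, `4 : R` (where the middle product is stored), `5 : T`, `6 : w`, `7 : e` as above,
`8 : j`. -/
def newtonStep {K : Type u} [CommRing K] (MP SP : Proc K) : Cmd K 9 :=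
  .call (unbalancedMP MP) [fun ρ => ρ 2, fun ρ => ρ 3, fun ρ => ρ 0 + 1, fun ρ => ρ 1,
    fun ρ => ρ 4, fun ρ => ρ 5, fun ρ => ρ 6, fun ρ => ρ 7] ;;
  .for 8 (fun ρ => ρ 3) (.neg (fun ρ => ρ 4 + ρ 8) (fun ρ => ρ 4 + ρ 8)) ;;
  .call SP.body [fun ρ => ρ 3, fun ρ => ρ 1, fun ρ => ρ 4, fun ρ => ρ 1 + ρ 2, fun ρ => ρ 6,
    fun ρ => ρ 7]

/-- The number `ℓ = min(k, ⌊(n - k)/c⌋)` of new coefficients computed when `k` are known. -/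
noncomputable def stepLen (c : ℝ) (n k : ℕ) : ℕ := min k ⌊((n - k : ℕ) : ℝ) / c⌋₊

/-- The values of `k` in the main loop of the algorithm: `1`, and then `k ← k + ℓ`. -/
noncomputable def knownCoeffs (c : ℝ) (n : ℕ) : ℕ → ℕ
  | 0 => 1
  | i + 1 => knownCoeffs c n i + stepLen c n (knownCoeffs c n i)

/-- In-place fast power series inversion.  `c` is the slow-down parameter of the algorithm, and `d`
is the number of further cells that `MP` and `SP` need besides their work space.
Index registers: `0 : n`, `1 : p` (address of `F`), `2 : q` (address of `G`), `3 : e` (address of the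
extra cells), `4 : k`, `5 : ℓ`; the first four are arguments.
In the main loop the middle product is stored in `G_[n-ℓ..n[`, and the free cells `G_[k..n-ℓ[`
(resp. `G_[k+ℓ..n-ℓ[`) serve as work space.  When `ℓ = 0`, fewer than `c` coefficients are missing;
the same step computes them with extra cells as work space. Its repetition concerns only the `n`
below `2 c`: otherwise one step suffices. -/
noncomputable def inPlaceInv {K : Type u} [CommRing K] (MP SP : Proc K) (c : ℝ) (d : ℕ) :
    Proc K where
  size := 6
  body :=
    .inv (fun ρ => ρ 2) (fun ρ => ρ 1) ;;
    .set 4 (fun _ => 1) ;;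
    .set 5 (fun ρ => stepLen c (ρ 0) (ρ 4)) ;;
    .loop (fun ρ => 0 < ρ 5)
      (.call (newtonStep MP SP) [fun ρ => ρ 1, fun ρ => ρ 2, fun ρ => ρ 4, fun ρ => ρ 5,
          fun ρ => ρ 2 + ρ 0 - ρ 5, fun ρ => ρ 2 + ρ 4, fun ρ => ρ 2 + ρ 4 + ρ 5, fun ρ => ρ 3] ;;
        .set 4 (fun ρ => ρ 4 + ρ 5) ;;
        .set 5 (fun ρ => stepLen c (ρ 0) (ρ 4))) ;;
    .loop (fun ρ => ρ 4 < ρ 0)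
      (.set 5 (fun ρ => min (ρ 4) (ρ 0 - ρ 4)) ;;
        .call (newtonStep MP SP) [fun ρ => ρ 1, fun ρ => ρ 2, fun ρ => ρ 4, fun ρ => ρ 5,
          fun ρ => ρ 3 + d, fun ρ => ρ 3 + d + ρ 5, fun ρ => ρ 3 + d + ρ 5 + ρ 5, fun ρ => ρ 3] ;;
        .set 4 (fun ρ => ρ 4 + ρ 5))

/-! ### Executions -/

/-! Newton iteration needs scratch space, and the part of the output that is not yet computed can
provide it. If G inverts F modulo X^k and F G ≡ 1 + X^k H modulo X^(k+l) with l ≤ k, then adding X^k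
(-G H mod X^l) to G gives precision k+l (`X_pow_dvd_newton`), and H is a middle product. Such a step
occupies l cells for H, l auxiliary cells for the middle products, and at most max(cm, cs) l cells
of work space: at most c l cells together, which fit into the n-k free output cells when c l ≤ n-k.
Once no l ≥ 1 satisfies this, fewer than c coefficients are missing, and a constant number of extra
cells suffices. `exists_exec_newtonStep` and `inPlaceInv_invertsWithin` verify this on the machine
and bound the number of operations by 1 + `loopCost`.

For the cost, let r = n-k be the number of missing coefficients. A step takes ⌈k/l⌉ middle products
and one short product in size l, and linear work. Superlinearity gives M(l) ≤ (M(n)/n) l, so the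
short products, and the middle products of the accelerating phase, add up to O(M(n)). In the
decelerating phase ⌈k/l⌉ M(l) ≤ M(k+l) ≤ M(n), and l > r/c - 1, so r-c shrinks by the factor (c-1)/c
as long as it is not small. There are thus at most log_{c/(c-1)}(n) + 3 such steps. This yields the
main term, and the linear work is O(n log n), hence O(M(n)).

If M(n) = n^(1+γ), the middle products of a decelerating step cost at most a constant times n l^γ;
as r decays geometrically, these terms sum to O(n^(1+γ)). `loopCost_le` treats both cases at once: a
potential Θ(r) pays for the middle products of the decelerating phase, and Ψ(r) counts its steps. -/

theorem Exec.mono {K : Type u} [CommRing K] {B : ℕ} {W W' : Set ℕ} (hW : W ⊆ W') {r : ℕ}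
    {p : Cmd K r} {ρ ρ' : Fin r → ℕ} {m m' : ℕ → K} {t : ℕ} (h : Exec B W p ρ m ρ' m' t) :
    Exec B W' p ρ m ρ' m' t := by
  induction h with
  | set h => exact .set h
  | const h => exact .const (hW h)
  | copy h => exact .copy (hW h)
  | arith h => exact .arith (hW h)
  | neg h => exact .neg (hW h)
  | inv h hy => exact .inv (hW h) hy
  | seq _ _ ihp ihq => exact .seq ihp ihq
  | cond_true h _ ih => exact .cond_true h ih
  | cond_false h _ ih => exact .cond_false h ih
  | loop_done h => exact .loop_done h
  | loop_step h _ _ ihp ihl => exact .loop_step h ihp ihl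
  | call h _ ih => exact .call h ih

/-- Cells outside the writable set keep their contents. -/
theorem Exec.eq_of_notMem {K : Type u} [CommRing K] {B : ℕ} {W : Set ℕ} {r : ℕ}
    {p : Cmd K r} {ρ ρ' : Fin r → ℕ} {m m' : ℕ → K} {t : ℕ} (h : Exec B W p ρ m ρ' m' t)
    {x : ℕ} (hx : x ∉ W) : m' x = m x := by
  induction h with
  | set h => rfl
  | const h => exact Function.update_of_ne (ne_of_mem_of_not_mem h hx).symm _ _
  | copy h => exact Function.update_of_ne (ne_of_mem_of_not_mem h hx).symm _ _
  | arith h => exact Function.update_of_ne (ne_of_mem_of_not_mem h hx).symm _ _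
  | neg h => exact Function.update_of_ne (ne_of_mem_of_not_mem h hx).symm _ _
  | inv h hy => exact Function.update_of_ne (ne_of_mem_of_not_mem h hx).symm _ _
  | seq _ _ ihp ihq => exact ihq.trans ihp
  | cond_true h _ ih => exact ih
  | cond_false h _ ih => exact ih
  | loop_done h => rfl
  | loop_step h _ _ ihp ihl => exact ihl.trans ihp
  | call h _ ih => exact ih

/-- A `for` loop whose `i`-th iteration writes the value `v i` into the cell `D + i`, with `τ`
operations. -/
theorem Exec.for_write {K : Type u} [CommRing K] {B : ℕ} {W : Set ℕ} {r : ℕ} {j : Fin r}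
    {bound : IdxExpr r} {body : Cmd K r} {ρ : Fin r → ℕ} {m : ℕ → K} {N D τ : ℕ} {v : ℕ → K}
    (hbound : ∀ i, bound (Function.update ρ j i) = N) (hN : N ≤ B)
    (hbody : ∀ i < N, ∀ m', (∀ x ∉ block D i, m' x = m x) →
      Exec B W body (Function.update ρ j i) m' (Function.update ρ j i)
        (Function.update m' (D + i) (v i)) τ) :
    ∃ m', Exec B W (.for j bound body) ρ m (Function.update ρ j N) m' (N * τ) ∧
      (∀ i < N, m' (D + i) = v i) ∧ ∀ x ∉ block D N, m' x = m x := by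
  -- Induction on the number u of remaining iterations. The invariant, that memory has changed only
  -- in the i cells already treated, is exactly what `hbody` asks for.
  have key : ∀ u i m', i + u = N → (∀ x < i, m' (D + x) = v x) → (∀ x ∉ block D i, m' x = m x) →
      ∃ m'', Exec B W (.loop (fun ρ => ρ j < bound ρ) (body ;; .set j (fun ρ => ρ j + 1)))
        (Function.update ρ j i) m' (Function.update ρ j N) m'' (u * τ) ∧
        (∀ i < N, m'' (D + i) = v i) ∧ ∀ x ∉ block D N, m'' x = m x := by
    intro u
    induction u with
    | zero =>
      intro i m' hi h1 h2
      obtain rfl : i = N := by omega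
      refine ⟨m', ?_, h1, h2⟩
      rw [Nat.zero_mul]
      exact .loop_done (by simp [hbound])
    | succ u ih =>
      intro i m' hi h1 h2
      obtain ⟨m'', he, h3, h4⟩ := ih (i + 1) (Function.update m' (D + i) (v i)) (by omega)
        (by
          intro x hx
          by_cases hxi : x = i
          · rw [hxi, Function.update_self]
          · rw [Function.update_of_ne (by omega)]
            exact h1 x (by omega))
        (by
          intro x hx
          simp only [block, Set.mem_Ico] at hx h2
          rw [Function.update_of_ne (by omega)]
          exact h2 x (by omega))
      refine ⟨m'', ?_, h3, h4⟩
      have hb := hbody i (by omega) m' h2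
      have hs : Exec B W (.set j (fun ρ => ρ j + 1)) (Function.update ρ j i)
          (Function.update m' (D + i) (v i)) (Function.update ρ j (i + 1))
          (Function.update m' (D + i) (v i)) 0 := by
        have := Exec.set (B := B) (W := W) (x := j) (e := fun ρ => ρ j + 1)
          (ρ := Function.update ρ j i) (m := Function.update m' (D + i) (v i))
          (by simp only [Function.update_self]; omega)
        simpa using this
      have := Exec.loop_step (b := fun ρ => ρ j < bound ρ) (by simp [hbound]; omega)
        (Exec.seq hb hs) he
      rwa [show τ + 0 + u * τ = (u + 1) * τ by ring] at this
  obtain ⟨m', he, h1, h2⟩ := key N 0 m (by omega) (by simp) (by simp)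
  refine ⟨m', ?_, h1, h2⟩
  have hs := Exec.set (B := B) (W := W) (x := j) (e := fun _ => 0) (ρ := ρ) (m := m) (Nat.zero_le _)
  have := Exec.seq hs he
  rwa [Nat.zero_add] at this

/-! ### Coefficients of polynomials in memory -/

section

variable {K : Type u} [CommRing K]

theorem coeff_polyAt (m : ℕ → K) (a n d : ℕ) :
    (polyAt m a n).coeff d = if d < n then m (a + d) else 0 := by
  simp [polyAt, coeff_C_mul, coeff_X_pow]

theorem polyAt_congr {m m' : ℕ → K} {a n : ℕ} (h : ∀ x ∈ block a n, m x = m' x) :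
    polyAt m a n = polyAt m' a n := by
  refine Finset.sum_congr rfl fun i hi => ?_
  rw [h (a + i) (by simpa [block] using hi)]

theorem coeff_mul_polyAt (F : K[X]) (m : ℕ → K) (a n d : ℕ) :
    (F * polyAt m a n).coeff d =
      ∑ i ∈ Finset.range n, if i ≤ d then m (a + i) * F.coeff (d - i) else 0 := by
  simp only [polyAt, Finset.mul_sum, finsetSum_coeff]
  refine Finset.sum_congr rfl fun i _ => ?_
  rw [mul_left_comm, coeff_C_mul, coeff_mul_X_pow']
  split_ifs <;> simp

theorem coeff_modByMonic_X_pow (F : K[X]) {n d : ℕ} (h : d < n) :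
    (F %ₘ X ^ n).coeff d = F.coeff d := by
  conv_rhs => rw [← modByMonic_add_div F (X ^ n)]
  rw [coeff_add, coeff_X_pow_mul', if_neg (by omega), add_zero]

theorem coeff_divByMonic_X_pow (F : K[X]) (n d : ℕ) :
    (F /ₘ X ^ n).coeff d = F.coeff (d + n) := by
  nontriviality K
  conv_rhs => rw [← modByMonic_add_div F (X ^ n)]
  rw [coeff_add, coeff_X_pow_mul, coeff_eq_zero_of_degree_lt (p := F %ₘ X ^ n), zero_add]
  refine (degree_modByMonic_lt F (monic_X_pow n)).trans_le ?_
  rw [degree_X_pow]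
  exact_mod_cast Nat.le_add_left n d

/-- For t < n and i < n the index n-1+t-i lies between 0 and 2n-2, so the convolution has all its n
terms and truncation plays no role. -/
theorem coeff_middleProduct {m : ℕ → K} {n a b t : ℕ} (ht : t < n) :
    (middleProduct n n (polyAt m a (2 * n - 1)) (polyAt m b n)).coeff t =
      ∑ i ∈ Finset.range n, m (b + i) * m (a + (n - 1 + t - i)) := by
  rw [middleProduct, coeff_modByMonic_X_pow _ ht, coeff_divByMonic_X_pow, coeff_mul_polyAt]
  refine Finset.sum_congr rfl fun i hi => ?_
  have := Finset.mem_range.1 hi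
  rw [if_pos (by omega), coeff_polyAt, if_pos (by omega)]
  congr 3
  omega

theorem X_pow_dvd_shortProduct_sub (n : ℕ) (F G : K[X]) :
    X ^ n ∣ shortProduct n F G - F * G := by
  rw [X_pow_dvd_iff]
  intro d hd
  rw [coeff_sub, shortProduct, coeff_modByMonic_X_pow _ hd, sub_self]

theorem polyAt_add (m : ℕ → K) (a k l : ℕ) :
    polyAt m a (k + l) = polyAt m a k + X ^ k * polyAt m (a + k) l := by
  rw [polyAt, Finset.sum_range_add]
  simp only [polyAt, Finset.mul_sum]
  congr 1
  refine Finset.sum_congr rfl fun i _ => ?_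
  rw [pow_add, ← add_assoc]
  ring

theorem polyAt_neg (m : ℕ → K) (a n : ℕ) : polyAt (fun x => -m x) a n = -polyAt m a n := by
  simp [polyAt]

/-- A generalized Newton step for the inverse of a power series: if `G` is an inverse of `F` at
precision `k`, `F G = 1 + X ^ k H` at precision `k + l` and `l ≤ k`, then
`G + X ^ k (G (-H) mod X ^ l)` is an inverse of `F` at precision `k + l`. -/
theorem X_pow_dvd_newton {F G G₀ H S : K[X]} {k l : ℕ} (hlk : l ≤ k)
    (hG : X ^ k ∣ F * G - 1) (hH : X ^ (k + l) ∣ F * G - 1 - X ^ k * H)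
    (hG₀ : X ^ l ∣ G - G₀) (hS : X ^ l ∣ S - G₀ * (-H)) :
    X ^ (k + l) ∣ F * (G + X ^ k * S) - 1 := by
  obtain ⟨a, ha⟩ := (pow_dvd_pow X hlk).trans hG
  obtain ⟨b, hb⟩ := hH
  obtain ⟨c, hc⟩ := hG₀
  obtain ⟨d, hd⟩ := hS
  -- Modulo X^(k+l) the left side is X^k H (1 - F G₀), and 1 - F G₀ is divisible by X^l because G
  -- inverts F modulo X^l (here l ≤ k is needed) and G₀ agrees with G there.
  refine ⟨b + F * d - H * a + F * H * c, ?_⟩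
  rw [pow_add] at *
  linear_combination hb + X ^ k * F * hd - X ^ k * H * ha + X ^ k * F * H * hc

end

/-! ### Blocks and frames -/

theorem mem_block {a n x : ℕ} : x ∈ block a n ↔ a ≤ x ∧ x < a + n := Iff.rfl

theorem block_subset_block {a n a' n' : ℕ} (h : a ≤ a') (h' : a' + n' ≤ a + n) :
    block a' n' ⊆ block a n :=
  Set.Ico_subset_Ico h h'

theorem disjoint_block_of_le {a n b k : ℕ} (h : a + n ≤ b) : Disjoint (block a n) (block b k) :=
  Set.disjoint_left.2 fun x hx hy => by rw [mem_block] at hx hy; omega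

theorem Disjoint.block_mono {a n b k a' n' b' k' : ℕ} (h : Disjoint (block a n) (block b k))
    (h₁ : a ≤ a') (h₂ : a' + n' ≤ a + n) (h₃ : b ≤ b') (h₄ : b' + k' ≤ b + k) :
    Disjoint (block a' n') (block b' k') :=
  h.mono (block_subset_block h₁ h₂) (block_subset_block h₃ h₄)

theorem Disjoint.notMem_block {a n b k x : ℕ} (h : Disjoint (block a n) (block b k))
    (h₁ : a ≤ x) (h₂ : x < a + n) : x ∉ block b k :=
  Set.disjoint_left.1 h ⟨h₁, h₂⟩

theorem frame_update {s : ℕ} (l : List ℕ) (x : Fin s) (v : ℕ) (h : (x : ℕ) < l.length) :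
    Function.update (frame s l) x v = frame s (l.set x v) := by
  funext i
  by_cases hi : i = x
  · subst hi
    simp [frame, h]
  · rw [Function.update_of_ne hi]
    simp [frame, List.getD_eq_getElem?_getD, Fin.val_ne_of_ne (Ne.symm hi)]

/-- Registers beyond the arguments start at zero. Listing such a zero explicitly gives a local
register an entry that `Exec.set_frame` can overwrite. -/
theorem frame_append_zero (s : ℕ) (l : List ℕ) : frame s (l ++ [0]) = frame s l := by
  funext i
  simp only [frame, List.getD_eq_getElem?_getD, List.getElem?_append]
  split_ifs with h
  · rfl
  · rw [List.getElem?_eq_none (Nat.le_of_not_lt h)]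
    rcases Nat.eq_zero_or_pos (i - l.length) with h0 | h0
    · simp [h0]
    · simp [h0.ne']

theorem Exec.set_frame {K : Type u} [CommRing K] {B : ℕ} {W : Set ℕ} {s : ℕ} {x : Fin s}
    {e : IdxExpr s} {l : List ℕ} {m : ℕ → K} (hx : (x : ℕ) < l.length) (h : e (frame s l) ≤ B) :
    Exec B W (.set x e) (frame s l) m (frame s (l.set x (e (frame s l)))) m 0 := by
  rw [← frame_update _ _ _ hx]
  exact .set h

/-! ### The middle product -/

section

variable {K : Type u} [CommRing K]

/-- The specification cell by cell. The size of the work space is a variable ω, so that the address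
inequalities are linear arithmetic over ℕ. -/
theorem Proc.IsMiddleProduct.exists_exec {P : Proc K} {T : ℕ → ℝ} {c : ℝ} {d : ℕ}
    (hP : P.IsMiddleProduct T c d) {n B a b o w e ω : ℕ} (m : ℕ → K) (hn : 1 ≤ n)
    (hω : ω = ⌊c * n⌋₊)
    (ha : a + (2 * n - 1) ≤ B) (hb : b + n ≤ B) (ho : o + n ≤ B) (hw : w + ω ≤ B) (he : e + d ≤ B)
    (how : Disjoint (block o n) (block w ω)) (hoe : Disjoint (block o n) (block e d))
    (hwe : Disjoint (block w ω) (block e d))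
    (hao : Disjoint (block a (2 * n - 1)) (block o n))
    (haw : Disjoint (block a (2 * n - 1)) (block w ω))
    (hae : Disjoint (block a (2 * n - 1)) (block e d))
    (hbo : Disjoint (block b n) (block o n)) (hbw : Disjoint (block b n) (block w ω))
    (hbe : Disjoint (block b n) (block e d)) :
    ∃ (ρ' : Fin P.size → ℕ) (m' : ℕ → K) (t : ℕ),
      Exec B (block o n ∪ block w ω ∪ block e d) P.body
        (frame P.size [n, a, b, o, w, e]) m ρ' m' t ∧
      (∀ i < n, m' (o + i) = ∑ j ∈ Finset.range n, m (b + j) * m (a + (n - 1 + i - j))) ∧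
      (t : ℝ) ≤ T n := by
  subst hω
  obtain ⟨ρ', m', t, h1, h2, h3⟩ := hP n B a b o w e m hn ha hb ho hw he how hoe hwe
    (by simp only [Set.disjoint_union_right]; exact ⟨⟨hao, haw⟩, hae⟩)
    (by simp only [Set.disjoint_union_right]; exact ⟨⟨hbo, hbw⟩, hbe⟩)
  refine ⟨ρ', m', t, h1, fun i hi => ?_, h3⟩
  rw [← coeff_middleProduct hi, ← h2, coeff_polyAt, if_pos hi]

/-- Correctness and cost of the middle product in size `(k + l - 1, k)`. -/
theorem exists_exec_unbalancedMP {P : Proc K} {T : ℕ → ℝ} {c : ℝ} {d : ℕ}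
    (hP : P.IsMiddleProduct T c d) {k l B f g r a w e ω : ℕ} (m : ℕ → K) (hl : 1 ≤ l) (hlk : l ≤ k)
    (hω : ω = ⌊c * l⌋₊)
    (hf : f + (k + l - 1) ≤ B) (hg : g + k ≤ B) (hr : r + l ≤ B) (ha : a + l ≤ B) (hw : w + ω ≤ B)
    (he : e + d ≤ B)
    (hra : Disjoint (block r l) (block a l)) (hrw : Disjoint (block r l) (block w ω))
    (hre : Disjoint (block r l) (block e d)) (haw : Disjoint (block a l) (block w ω))
    (hae : Disjoint (block a l) (block e d)) (hwe : Disjoint (block w ω) (block e d))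
    (hfr : Disjoint (block f (k + l - 1)) (block r l))
    (hfa : Disjoint (block f (k + l - 1)) (block a l))
    (hfw : Disjoint (block f (k + l - 1)) (block w ω))
    (hfe : Disjoint (block f (k + l - 1)) (block e d))
    (hgr : Disjoint (block g k) (block r l)) (hga : Disjoint (block g k) (block a l))
    (hgw : Disjoint (block g k) (block w ω)) (hge : Disjoint (block g k) (block e d)) :
    ∃ (ρ' : Fin 10 → ℕ) (m' : ℕ → K) (t : ℕ),
      Exec B (block r l ∪ block a l ∪ block w ω ∪ block e d) (unbalancedMP P)
        (frame 10 [k, l, f, g, r, a, w, e]) m ρ' m' t ∧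
      (∀ i < l, m' (r + i) = ∑ j ∈ Finset.range k, m (g + j) * m (f + (k - 1 + i - j))) ∧
      (t : ℝ) ≤ ((k - 1) / l + 1 : ℕ) * T l + ((k - 1) / l : ℕ) * l := by
  set W := block r l ∪ block a l ∪ block w ω ∪ block e d with hW
  have hmW : ∀ x, x ∉ W ↔ ((x ∉ block r l ∧ x ∉ block a l) ∧ x ∉ block w ω) ∧ x ∉ block e d := by
    intro x; simp only [hW, Set.mem_union, not_or]
  have hWf : ∀ x, f ≤ x → x < f + (k + l - 1) → x ∉ W := fun x h1 h2 => (hmW x).2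
    ⟨⟨⟨hfr.notMem_block h1 h2, hfa.notMem_block h1 h2⟩, hfw.notMem_block h1 h2⟩,
      hfe.notMem_block h1 h2⟩
  have hWg : ∀ x, g ≤ x → x < g + k → x ∉ W := fun x h1 h2 => (hmW x).2
    ⟨⟨⟨hgr.notMem_block h1 h2, hga.notMem_block h1 h2⟩, hgw.notMem_block h1 h2⟩,
      hge.notMem_block h1 h2⟩
  have hrW : block r l ∪ block w ω ∪ block e d ⊆ W := by
    intro x; simp only [hW, Set.mem_union]; tauto
  have haW : block a l ∪ block w ω ∪ block e d ⊆ W := by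
    intro x; simp only [hW, Set.mem_union]; tauto
  -- the loop over the pieces of size `l`
  have hloop : ∀ u s m', s + u * l = k → 1 ≤ s → (∀ x ∉ W, m' x = m x) →
      (∀ i < l, m' (r + i) = ∑ j ∈ Finset.range s, m (g + j) * m (f + (k - 1 + i - j))) →
      ∃ m'' t, Exec B W (.loop (fun ρ => ρ 8 < ρ 0)
          (.call P.body [fun ρ => ρ 1, fun ρ => ρ 2 + (ρ 0 - ρ 8 - ρ 1), fun ρ => ρ 3 + ρ 8,
              fun ρ => ρ 5, fun ρ => ρ 6, fun ρ => ρ 7] ;;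
            .for 9 (fun ρ => ρ 1)
              (.arith .add (fun ρ => ρ 4 + ρ 9) (fun ρ => ρ 4 + ρ 9) (fun ρ => ρ 5 + ρ 9)) ;;
            .set 8 (fun ρ => ρ 8 + ρ 1)))
          (frame 10 [k, l, f, g, r, a, w, e, s, l]) m' (frame 10 [k, l, f, g, r, a, w, e, k, l])
          m'' t ∧
        (∀ i < l, m'' (r + i) = ∑ j ∈ Finset.range k, m (g + j) * m (f + (k - 1 + i - j))) ∧
        (t : ℝ) ≤ u * (T l + l) := by
    intro u
    induction u with
    | zero =>
      intro s m' hs _ _ h2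
      obtain rfl : s = k := by omega
      exact ⟨m', 0, .loop_done (lt_irrefl s), h2, by simp⟩
    | succ u ih =>
      intro s m' hs hs1 h1 h2
      have hs' : s + l + u * l = k := by rw [← hs]; ring
      have hsk : s + l ≤ k := by omega
      -- The piece of G that starts at s is paired with F at offset k-s-l: the local index l-1+i-j
      -- then becomes k-1+i-(s+j), as the full sum requires.
      obtain ⟨ρ₁, m₁, t₁, e₁, v₁, ht₁⟩ := hP.exists_exec (n := l) (B := B)
        (a := f + (k - s - l)) (b := g + s) (o := a) (w := w) (e := e) m' hl hω
        (by omega) (by omega) ha hw he haw hae hwe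
        (hfa.block_mono (by omega) (by omega) le_rfl le_rfl)
        (hfw.block_mono (by omega) (by omega) le_rfl le_rfl)
        (hfe.block_mono (by omega) (by omega) le_rfl le_rfl)
        (hga.block_mono (by omega) (by omega) le_rfl le_rfl)
        (hgw.block_mono (by omega) (by omega) le_rfl le_rfl)
        (hge.block_mono (by omega) (by omega) le_rfl le_rfl)
      have hm₁r : ∀ i < l, m₁ (r + i) = m' (r + i) := fun i hi => by
        refine e₁.eq_of_notMem ?_
        simp only [Set.mem_union, not_or]
        exact ⟨⟨hra.notMem_block (by omega) (by omega), hrw.notMem_block (by omega) (by omega)⟩,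
          hre.notMem_block (by omega) (by omega)⟩
      obtain ⟨m₂, e₂, v₂, hm₂⟩ := Exec.for_write (B := B) (W := W) (j := (9 : Fin 10))
        (bound := fun ρ => ρ 1)
        (body := .arith .add (fun ρ => ρ 4 + ρ 9) (fun ρ => ρ 4 + ρ 9) (fun ρ => ρ 5 + ρ 9))
        (ρ := frame 10 [k, l, f, g, r, a, w, e, s, l]) (m := m₁) (N := l) (D := r) (τ := 1)
        (v := fun i => m₁ (r + i) + m₁ (a + i)) (fun i => rfl) (by omega)
        (by
          intro i hi m₂ hm₂
          have hv : m₁ (r + i) + m₁ (a + i) = ArithOp.add.eval (m₂ (r + i)) (m₂ (a + i)) := by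
            rw [hm₂ (r + i) (by rw [mem_block]; omega), hm₂ (a + i)
              ((hra.symm.block_mono le_rfl le_rfl le_rfl (by omega)).notMem_block (by omega)
                (by omega))]
            rfl
          simp only [hv]
          exact .arith (Or.inl (Or.inl (Or.inl ⟨Nat.le_add_right _ _, Nat.add_lt_add_left hi _⟩))))
      rw [frame_update _ _ _ (by simp)] at e₂
      obtain ⟨m₃, t₃, e₃, v₃, ht₃⟩ := ih (s + l) m₂ hs' (by omega)
        (by
          intro x hx
          rw [hm₂ x ((hmW x).1 hx).1.1.1, e₁.eq_of_notMem (fun h => hx (haW h)), h1 x hx])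
        (by
          intro i hi
          rw [v₂ i hi, hm₁r i hi, h2 i hi, v₁ i hi, Finset.sum_range_add]
          congr 1
          refine Finset.sum_congr rfl fun j hj => ?_
          have hj := Finset.mem_range.1 hj
          rw [h1 _ (hWg _ (by omega) (by omega)), h1 _ (hWf _ (by omega) (by omega)), add_assoc]
          congr 2
          omega)
      refine ⟨m₃, t₁ + (l * 1 + 0) + t₃, .loop_step (show s < k by omega)
        (.seq (.call ?_ (e₁.mono haW)) (.seq e₂ (.set_frame (by simp) ?_))) e₃, v₃, ?_⟩
      · simp only [List.forall_mem_cons, List.not_mem_nil, false_implies, implies_true, and_true]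
        change l ≤ B ∧ f + (k - s - l) ≤ B ∧ g + s ≤ B ∧ a ≤ B ∧ w ≤ B ∧ e ≤ B
        omega
      · change s + l ≤ B
        omega
      · push_cast
        linarith
  -- the first piece
  set u := (k - 1) / l with hu
  have hdiv : u * l + (k - 1) % l = k - 1 := Nat.div_add_mod' _ _
  have hmod : (k - 1) % l < l := Nat.mod_lt _ hl
  -- As u = ⌈k/l⌉ - 1, the first piece has size s = (k-1) mod l + 1, between 1 and l; u full pieces
  -- remain.
  obtain ⟨s, hs⟩ : ∃ s, s = k - u * l := ⟨_, rfl⟩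
  obtain ⟨m₁, e₁, v₁, hm₁⟩ := Exec.for_write (B := B) (W := W) (j := (9 : Fin 10))
    (bound := fun ρ => ρ 1)
    (body := .cond (fun ρ => ρ 9 < ρ 8)
      (.copy (fun ρ => ρ 5 + ρ 9) (fun ρ => ρ 3 + ρ 9))
      (.const (fun ρ => ρ 5 + ρ 9) (fun _ => 0)))
    (ρ := frame 10 [k, l, f, g, r, a, w, e, s, 0]) (m := m) (N := l) (D := a) (τ := 0)
    (v := fun i => if i < s then m (g + i) else 0) (fun i => rfl) (by omega)
    (by
      intro i hi m₁ hm₁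
      have hiW : a + i ∈ W :=
        Or.inl (Or.inl (Or.inr ⟨Nat.le_add_right _ _, Nat.add_lt_add_left hi _⟩))
      by_cases his : i < s
      · have hv : m (g + i) = m₁ (g + i) := (hm₁ _
          ((hga.block_mono le_rfl le_rfl le_rfl (by omega)).notMem_block (by omega)
                (by omega))).symm
        simp only [if_pos his, hv]
        exact .cond_true his (.copy hiW)
      · simp only [if_neg his]
        exact .cond_false his (.const hiW))
  rw [frame_update _ _ _ (by simp)] at e₁
  obtain ⟨ρ₂, m₂, t₂, e₂, v₂, ht₂⟩ := hP.exists_exec (n := l) (B := B)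
    (a := f + (k - l)) (b := a) (o := r) (w := w) (e := e) m₁ hl hω
    (by omega) (by omega) hr hw he hrw hre hwe
    (hfr.block_mono (by omega) (by omega) le_rfl le_rfl)
    (hfw.block_mono (by omega) (by omega) le_rfl le_rfl)
    (hfe.block_mono (by omega) (by omega) le_rfl le_rfl)
    hra.symm haw hae
  obtain ⟨m₃, t₃, e₃, v₃, ht₃⟩ := hloop u s m₂ (by omega) (by omega)
    (by
      intro x hx
      rw [e₂.eq_of_notMem (fun h => hx (hrW h)), hm₁ x ((hmW x).1 hx).1.1.2])
    (by
      intro i hi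
      rw [v₂ i hi]
      symm
      -- The product runs over l entries, but those from s on are the padding zeros.
      refine Finset.sum_subset_zero_on_sdiff (Finset.range_subset_range.2 (by omega)) ?_ ?_
      · intro j hj
        simp only [Finset.mem_sdiff, Finset.mem_range] at hj
        rw [v₁ j hj.1, if_neg hj.2, zero_mul]
      · intro j hj
        have hj := Finset.mem_range.1 hj
        rw [v₁ j (by omega), if_pos hj, hm₁ _ (hfa.notMem_block (by omega) (by omega))]
        congr 2
        omega)
  have e₀ : Exec B W (.set 8 (fun ρ => ρ 0 - (ρ 0 - 1) / ρ 1 * ρ 1))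
      (frame 10 [k, l, f, g, r, a, w, e]) m (frame 10 [k, l, f, g, r, a, w, e, s, 0]) m 0 := by
    have : k - u * l ≤ B := by omega
    rw [hs, ← frame_append_zero, ← frame_append_zero]
    exact .set_frame (by simp) this
  refine ⟨_, m₃, _, .seq e₀ (.seq e₁ (.seq (.call ?_ (e₂.mono hrW)) e₃)), v₃, ?_⟩
  · simp only [List.forall_mem_cons, List.not_mem_nil, false_implies, implies_true, and_true]
    change l ≤ B ∧ f + (k - l) ≤ B ∧ a ≤ B ∧ r ≤ B ∧ w ≤ B ∧ e ≤ B
    omega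
  · push_cast
    linarith

end

/-! ### The Newton step -/

/-- A bound for the number of operations of a Newton step from `k` to `k + l` coefficients, if
middle and short products in size `l` take `A l` and `S l` operations. -/
def stepCost (A S : ℕ → ℝ) (k l : ℕ) : ℝ :=
  ((k - 1) / l + 1 : ℕ) * A l + ((k - 1) / l : ℕ) * l + l + S l

section

variable {K : Type u} [CommRing K]

theorem Proc.IsShortProduct.exists_exec {P : Proc K} {T : ℕ → ℝ} {c : ℝ} {d : ℕ}
    (hP : P.IsShortProduct T c d) {n B a b o w e : ℕ} (m : ℕ → K) (hn : 1 ≤ n) {ω : ℕ}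
    (hω : ω = ⌊c * n⌋₊)
    (ha : a + n ≤ B) (hb : b + n ≤ B) (ho : o + n ≤ B) (hw : w + ω ≤ B) (he : e + d ≤ B)
    (how : Disjoint (block o n) (block w ω)) (hoe : Disjoint (block o n) (block e d))
    (hwe : Disjoint (block w ω) (block e d))
    (hao : Disjoint (block a n) (block o n)) (haw : Disjoint (block a n) (block w ω))
    (hae : Disjoint (block a n) (block e d))
    (hbo : Disjoint (block b n) (block o n)) (hbw : Disjoint (block b n) (block w ω))
    (hbe : Disjoint (block b n) (block e d)) :
    ∃ (ρ' : Fin P.size → ℕ) (m' : ℕ → K) (t : ℕ),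
      Exec B (block o n ∪ block w ω ∪ block e d) P.body
        (frame P.size [n, a, b, o, w, e]) m ρ' m' t ∧
      polyAt m' o n = shortProduct n (polyAt m a n) (polyAt m b n) ∧
      (t : ℝ) ≤ T n := by
  subst hω
  exact hP n B a b o w e m hn ha hb ho hw he how hoe hwe
    (by simp only [Set.disjoint_union_right]; exact ⟨⟨hao, haw⟩, hae⟩)
    (by simp only [Set.disjoint_union_right]; exact ⟨⟨hbo, hbw⟩, hbe⟩)

/-- If the cells at `r` hold the middle product of `F` (without its constant coefficient) and `G`,
then they hold the coefficients `k, …, k + l - 1` of `F G`. -/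
theorem X_pow_dvd_sub_polyAt {m m' : ℕ → K} {p q r k l n : ℕ} (hk : 1 ≤ k) (hkl : k + l ≤ n)
    (hG : X ^ k ∣ polyAt m p n * polyAt m q k - 1)
    (hr : ∀ i < l, m' (r + i) =
      ∑ j ∈ Finset.range k, m (q + j) * m (p + 1 + (k - 1 + i - j))) :
    X ^ (k + l) ∣ polyAt m p n * polyAt m q k - 1 - X ^ k * polyAt m' r l := by
  rw [X_pow_dvd_iff] at hG ⊢
  intro d hd
  rw [coeff_sub, coeff_X_pow_mul']
  split_ifs with hdk
  · obtain ⟨i, rfl⟩ := Nat.exists_eq_add_of_le hdk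
    rw [coeff_sub, coeff_one, if_neg (by omega), sub_zero, coeff_mul_polyAt,
      Nat.add_sub_cancel_left, coeff_polyAt, if_pos (by omega), hr i (by omega), sub_eq_zero]
    refine Finset.sum_congr rfl fun j hj => ?_
    have hj := Finset.mem_range.1 hj
    -- Since j < k, the index k+i-j is at least 1: the constant coefficient of F never enters, which
    -- is why the middle product may start at address p+1.
    rw [if_pos (by omega), coeff_polyAt, if_pos (by omega)]
    congr 2
    omega
  · rw [hG d (by omega), sub_zero]

/-- Correctness and cost of a Newton step. -/
theorem exists_exec_newtonStep {MP SP : Proc K} {A S : ℕ → ℝ} {cm cs : ℝ} {dm ds : ℕ}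
    (hMP : MP.IsMiddleProduct A cm dm) (hSP : SP.IsShortProduct S cs ds)
    {k l n B p q r a w e ω d : ℕ} (m : ℕ → K) (hl : 1 ≤ l) (hlk : l ≤ k) (hkl : k + l ≤ n)
    (hωm : ⌊cm * l⌋₊ ≤ ω) (hωs : ⌊cs * l⌋₊ ≤ ω) (hdm : dm ≤ d) (hds : ds ≤ d)
    (hp : p + (k + l) ≤ B) (hq : q + k + l ≤ B) (hr : r + l ≤ B) (ha : a + l ≤ B) (hw : w + ω ≤ B)
    (he : e + d ≤ B)
    (hra : Disjoint (block r l) (block a l)) (hrw : Disjoint (block r l) (block w ω))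
    (hre : Disjoint (block r l) (block e d)) (haw : Disjoint (block a l) (block w ω))
    (hae : Disjoint (block a l) (block e d)) (hwe : Disjoint (block w ω) (block e d))
    (hqr : Disjoint (block q (k + l)) (block r l))
    (hqa : Disjoint (block q k) (block a l))
    (hqw : Disjoint (block q (k + l)) (block w ω)) (hqe : Disjoint (block q (k + l)) (block e d))
    (hpr : Disjoint (block p (k + l)) (block r l)) (hpa : Disjoint (block p (k + l)) (block a l))
    (hpw : Disjoint (block p (k + l)) (block w ω)) (hpe : Disjoint (block p (k + l)) (block e d)) :
    ∃ (ρ' : Fin 9 → ℕ) (m' : ℕ → K) (t : ℕ),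
      Exec B (block r l ∪ block a l ∪ block w ω ∪ block e d ∪ block (q + k) l) (newtonStep MP SP)
        (frame 9 [p, q, k, l, r, a, w, e]) m ρ' m' t ∧
      (X ^ k ∣ polyAt m p n * polyAt m q k - 1 →
        X ^ (k + l) ∣ polyAt m p n * polyAt m' q (k + l) - 1) ∧
      (t : ℝ) ≤ stepCost A S k l := by
  set W := block r l ∪ block a l ∪ block w ω ∪ block e d ∪ block (q + k) l with hW
  have hqW : ∀ x ∈ block q k, x ∉ W := by
    rintro x ⟨h1, h2⟩
    simp only [hW, Set.mem_union, not_or]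
    refine ⟨⟨⟨⟨?_, ?_⟩, ?_⟩, ?_⟩, ?_⟩
    · exact hqr.notMem_block h1 (by omega)
    · exact hqa.notMem_block h1 h2
    · exact hqw.notMem_block h1 (by omega)
    · exact hqe.notMem_block h1 (by omega)
    · rw [mem_block]; omega
  have hW₁ : block r l ∪ block a l ∪ block w ⌊cm * l⌋₊ ∪ block e dm ⊆ W := by
    have h1 := block_subset_block (a := w) le_rfl (Nat.add_le_add_left hωm w)
    have h2 := block_subset_block (a := e) le_rfl (Nat.add_le_add_left hdm e)
    intro x
    have := @h1 x
    have := @h2 x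
    simp only [hW, Set.mem_union]
    tauto
  have hW₃ : block (q + k) l ∪ block w ⌊cs * l⌋₊ ∪ block e ds ⊆ W := by
    have h1 := block_subset_block (a := w) le_rfl (Nat.add_le_add_left hωs w)
    have h2 := block_subset_block (a := e) le_rfl (Nat.add_le_add_left hds e)
    intro x
    have := @h1 x
    have := @h2 x
    simp only [hW, Set.mem_union]
    tauto
  obtain ⟨ρ₁, m₁, t₁, e₁, v₁, ht₁⟩ := exists_exec_unbalancedMP hMP (k := k) (l := l) (B := B)
    (f := p + 1) (g := q) (r := r) (a := a) (w := w) (e := e) m hl hlk rfl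
    (by omega) (by omega) hr ha (by omega) (by omega) hra
    (hrw.block_mono le_rfl le_rfl le_rfl (by omega))
    (hre.block_mono le_rfl le_rfl le_rfl (by omega))
    (haw.block_mono le_rfl le_rfl le_rfl (by omega))
    (hae.block_mono le_rfl le_rfl le_rfl (by omega))
    (hwe.block_mono le_rfl (by omega) le_rfl (by omega))
    (hpr.block_mono (by omega) (by omega) le_rfl le_rfl)
    (hpa.block_mono (by omega) (by omega) le_rfl le_rfl)
    (hpw.block_mono (by omega) (by omega) le_rfl (by omega))
    (hpe.block_mono (by omega) (by omega) le_rfl (by omega))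
    (hqr.block_mono le_rfl (by omega) le_rfl le_rfl) hqa
    (hqw.block_mono le_rfl (by omega) le_rfl (by omega))
    (hqe.block_mono le_rfl (by omega) le_rfl (by omega))
  obtain ⟨m₂, e₂, v₂, hm₂⟩ := Exec.for_write (B := B) (W := W) (j := (8 : Fin 9))
    (bound := fun ρ => ρ 3)
    (body := .neg (fun ρ => ρ 4 + ρ 8) (fun ρ => ρ 4 + ρ 8))
    (ρ := frame 9 [p, q, k, l, r, a, w, e, 0]) (m := m₁) (N := l) (D := r) (τ := 1)
    (v := fun i => -m₁ (r + i)) (fun i => rfl) (by omega)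
    (by
      intro i hi m₂ hm₂
      have hv : -m₁ (r + i) = -m₂ (r + i) := by
        rw [hm₂ (r + i) (by rw [mem_block]; omega)]
      simp only [hv]
      exact .neg (Or.inl (Or.inl (Or.inl (Or.inl
        ⟨Nat.le_add_right _ _, Nat.add_lt_add_left hi _⟩)))))
  rw [frame_update _ _ _ (by simp), show frame 9 [p, q, k, l, r, a, w, e, 0] =
    frame 9 [p, q, k, l, r, a, w, e] from frame_append_zero 9 [p, q, k, l, r, a, w, e]] at e₂
  -- The short product is written at q+k, which is allowed to overlap the auxiliary cells at a: they
  -- are no longer needed, and `hqa` protects only the k known coefficients.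
  obtain ⟨ρ₃, m₃, t₃, e₃, v₃, ht₃⟩ := hSP.exists_exec (n := l) (B := B)
    (a := q) (b := r) (o := q + k) (w := w) (e := e) m₂ hl rfl
    (by omega) (by omega) hq (by omega) (by omega)
    (hqw.block_mono (by omega) (by omega) le_rfl (by omega))
    (hqe.block_mono (by omega) (by omega) le_rfl (by omega))
    (hwe.block_mono le_rfl (by omega) le_rfl (by omega))
    (disjoint_block_of_le (by omega))
    (hqw.block_mono le_rfl (by omega) le_rfl (by omega))
    (hqe.block_mono le_rfl (by omega) le_rfl (by omega))
    (hqr.symm.block_mono le_rfl le_rfl (by omega) (by omega))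
    (hrw.block_mono le_rfl le_rfl le_rfl (by omega))
    (hre.block_mono le_rfl le_rfl le_rfl (by omega))
  refine ⟨_, m₃, _, .seq (.call ?_ (e₁.mono hW₁)) (.seq e₂
    (.call ?_ (e₃.mono hW₃))), fun hG => ?_, ?_⟩
  · simp only [List.forall_mem_cons, List.not_mem_nil, false_implies, implies_true, and_true]
    change k ≤ B ∧ l ≤ B ∧ p + 1 ≤ B ∧ q ≤ B ∧ r ≤ B ∧ a ≤ B ∧ w ≤ B ∧ e ≤ B
    omega
  · simp only [List.forall_mem_cons, List.not_mem_nil, false_implies, implies_true, and_true]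
    change l ≤ B ∧ q ≤ B ∧ r ≤ B ∧ q + k ≤ B ∧ w ≤ B ∧ e ≤ B
    omega
  · have hq₂ : ∀ x ∈ block q k, m₂ x = m x := fun x hx => by
      rw [hm₂ x (hqr.notMem_block hx.1 (by have := hx.2; omega)),
        e₁.eq_of_notMem (fun h => hqW x hx (hW₁ h))]
    have hq₃ : polyAt m₃ q k = polyAt m q k := polyAt_congr fun x hx => by
      rw [e₃.eq_of_notMem (fun h => hqW x hx (hW₃ h)), hq₂ x hx]
    have hl₂ : polyAt m₂ q l = polyAt m q l := polyAt_congr fun x hx =>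
      hq₂ x (block_subset_block le_rfl (by omega) hx)
    have hneg : polyAt m₂ r l = -polyAt m₁ r l := by
      rw [← polyAt_neg]
      refine polyAt_congr fun x hx => ?_
      obtain ⟨i, rfl⟩ := Nat.exists_eq_add_of_le hx.1
      exact v₂ i (by have := hx.2; omega)
    rw [polyAt_add, hq₃]
    refine X_pow_dvd_newton (G₀ := polyAt m q l) (H := polyAt m₁ r l) hlk hG
      (X_pow_dvd_sub_polyAt (hl.trans hlk) hkl hG v₁) ?_ ?_
    · obtain ⟨i, rfl⟩ := Nat.exists_eq_add_of_le hlk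
      rw [polyAt_add, add_sub_cancel_left]
      exact dvd_mul_right _ _
    · rw [v₃, hl₂, hneg]
      exact X_pow_dvd_shortProduct_sub _ _ _
  · rw [stepCost]
    push_cast at ht₁ ⊢
    linarith

end

/-! ### The algorithm -/

theorem stepLen_le (c : ℝ) (n k : ℕ) : stepLen c n k ≤ k := min_le_left _ _

theorem lt_of_stepLen_pos {c : ℝ} {n k : ℕ} (h : 0 < stepLen c n k) : k < n := by
  by_contra hk
  rw [stepLen, Nat.sub_eq_zero_of_le (not_lt.1 hk)] at h
  simp at h

/-- This is the space condition: the free cells of the output can hold c l cells of scratch. -/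
theorem mul_stepLen_le {c : ℝ} (hc : 0 < c) (n k : ℕ) : c * stepLen c n k ≤ (n - k : ℕ) := by
  have h : (stepLen c n k : ℝ) ≤ ((n - k : ℕ) : ℝ) / c :=
    (Nat.cast_le.2 (min_le_right _ _)).trans (Nat.floor_le (by positivity))
  rwa [le_div_iff₀' hc] at h

theorem sub_lt_of_stepLen_eq_zero {c : ℝ} (hc : 0 < c) {n k : ℕ} (hk : 1 ≤ k)
    (h : stepLen c n k = 0) : ((n - k : ℕ) : ℝ) < c := by
  have h1 : ⌊((n - k : ℕ) : ℝ) / c⌋₊ = 0 := by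
    rw [stepLen] at h
    omega
  rwa [Nat.floor_eq_zero, div_lt_one hc] at h1

theorem add_stepLen_le {c : ℝ} (hc : 1 ≤ c) {n k : ℕ} (hk : k ≤ n) : k + stepLen c n k ≤ n := by
  have h1 := mul_stepLen_le (zero_lt_one.trans_le hc) n k
  have h2 : (stepLen c n k : ℝ) ≤ (n - k : ℕ) :=
    (le_mul_of_one_le_left (Nat.cast_nonneg _) hc).trans h1
  have := Nat.cast_le.1 h2
  omega

/-- The cost of the last loop of the algorithm when `k` coefficients are known, if a step from `k`
to `k + l` coefficients costs `C k l`. -/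
def finalCost (C : ℕ → ℕ → ℝ) (n k : ℕ) : ℝ :=
  if _h : 0 < k ∧ k < n then
    C k (min k (n - k)) + finalCost C n (k + min k (n - k))
  else 0
termination_by n - k
decreasing_by omega

/-- The cost of the two loops of the algorithm when `k` coefficients are known, if a step from `k`
to `k + l` coefficients costs `C k l`. -/
noncomputable def loopCost (C : ℕ → ℕ → ℝ) (c : ℝ) (n k : ℕ) : ℝ :=
  if _h : 0 < stepLen c n k then
    C k (stepLen c n k) + loopCost C c n (k + stepLen c n k)
  else finalCost C n k
termination_by n - k
decreasing_by
  have := lt_of_stepLen_pos _h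
  omega

section

variable {K : Type u} [CommRing K]

theorem inPlaceInv_invertsWithin {MP SP : Proc K} {A S : ℕ → ℝ} {cm cs : ℝ} {dm ds : ℕ}
    (hMP : MP.IsMiddleProduct A cm dm) (hSP : SP.IsShortProduct S cs ds) (hcm : 0 ≤ cm) {c : ℝ}
    (hc : c = 2 + max cm cs) {n : ℕ} (hn : 1 ≤ n) :
    (inPlaceInv MP SP c (max dm ds)).InvertsWithin
      (max dm ds + 2 * ⌊c⌋₊ + ⌊max cm cs * ⌊c⌋₊⌋₊ + (inPlaceInv MP SP c (max dm ds)).body.regs) n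
      (1 + loopCost (stepCost A S) c n 1) := by
  refine ⟨_, le_rfl, ?_⟩
  intro B p q e m hpB hqB heB hqe hpW hu
  set d := max dm ds
  -- The last loop has l ≤ ⌊c⌋: d further cells, two blocks for the result and the auxiliary cells,
  -- and one work space.
  set s := d + 2 * ⌊c⌋₊ + ⌊max cm cs * ⌊c⌋₊⌋₊ with hs
  set W := block q n ∪ block e s with hW
  have hμ : 0 ≤ max cm cs := hcm.trans (le_max_left _ _)
  have hc2 : 2 ≤ c := by linarith
  have hpq : Disjoint (block p n) (block q n) := hpW.mono_right Set.subset_union_left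
  have hpe : Disjoint (block p n) (block e s) := hpW.mono_right Set.subset_union_right
  have hpF : ∀ m' : ℕ → K, (∀ x ∉ W, m' x = m x) → polyAt m' p n = polyAt m p n :=
    fun m' hm' => polyAt_congr fun x hx => hm' x (Set.disjoint_left.1 hpW hx)
  have hωm : ∀ l : ℕ, ⌊cm * l⌋₊ ≤ ⌊max cm cs * l⌋₊ := fun l =>
    Nat.floor_mono (mul_le_mul_of_nonneg_right (le_max_left _ _) (Nat.cast_nonneg _))
  have hωs : ∀ l : ℕ, ⌊cs * l⌋₊ ≤ ⌊max cm cs * l⌋₊ := fun l =>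
    Nat.floor_mono (mul_le_mul_of_nonneg_right (le_max_right _ _) (Nat.cast_nonneg _))
  have hqW : block q n ⊆ W := Set.subset_union_left
  have heW : block e s ⊆ W := Set.subset_union_right
  -- the last loop
  have hfinal : ∀ N k l m', n - k = N → 1 ≤ k → k ≤ n → ((n - k : ℕ) : ℝ) < c →
      (∀ x ∉ W, m' x = m x) → X ^ k ∣ polyAt m p n * polyAt m' q k - 1 →
      ∃ l' m'' t, Exec B W (.loop (fun ρ => ρ 4 < ρ 0)
          (.set 5 (fun ρ => min (ρ 4) (ρ 0 - ρ 4)) ;;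
            .call (newtonStep MP SP) [fun ρ => ρ 1, fun ρ => ρ 2, fun ρ => ρ 4, fun ρ => ρ 5,
              fun ρ => ρ 3 + d, fun ρ => ρ 3 + d + ρ 5, fun ρ => ρ 3 + d + ρ 5 + ρ 5,
              fun ρ => ρ 3] ;;
            .set 4 (fun ρ => ρ 4 + ρ 5)))
          (frame 6 [n, p, q, e, k, l]) m' (frame 6 [n, p, q, e, n, l']) m'' t ∧
        X ^ n ∣ polyAt m p n * polyAt m'' q n - 1 ∧
        (t : ℝ) ≤ finalCost (stepCost A S) n k := by
    intro N
    induction N using Nat.strong_induction_on with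
    | _ N ih =>
    intro k l₀ m' hN hk hkn hkc hm' hG
    rcases hkn.eq_or_lt with rfl | hlt
    · refine ⟨l₀, m', 0, .loop_done (lt_irrefl k), hG, ?_⟩
      rw [finalCost, dif_neg (by omega)]
      simp
    obtain ⟨l, hl⟩ : ∃ l, l = min k (n - k) := ⟨_, rfl⟩
    have hlc : l ≤ ⌊c⌋₊ :=
      (Nat.le_floor hkc.le : n - k ≤ ⌊c⌋₊).trans' (by omega)
    have hωl : ⌊max cm cs * l⌋₊ ≤ ⌊max cm cs * ⌊c⌋₊⌋₊ := Nat.floor_mono (by gcongr)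
    obtain ⟨ρ₁, m₁, t₁, e₁, hG₁, ht₁⟩ := exists_exec_newtonStep hMP hSP (k := k) (l := l)
      (n := n) (B := B) (p := p) (q := q) (r := e + d) (a := e + d + l) (w := e + d + l + l) (e := e)
      (ω := ⌊max cm cs * l⌋₊) (d := d) m' (by omega) (by omega) (by omega) (hωm l) (hωs l)
      (le_max_left _ _) (le_max_right _ _)
      (by omega) (by omega) (by omega) (by omega) (by omega) (by omega)
      (disjoint_block_of_le (by omega)) (disjoint_block_of_le (by omega))
      (disjoint_block_of_le (by omega)).symm (disjoint_block_of_le (by omega))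
      (disjoint_block_of_le (by omega)).symm (disjoint_block_of_le (by omega)).symm
      (hqe.block_mono le_rfl (by omega) (by omega) (by omega))
      (hqe.block_mono le_rfl (by omega) (by omega) (by omega))
      (hqe.block_mono le_rfl (by omega) (by omega) (by omega))
      (hqe.block_mono le_rfl (by omega) (by omega) (by omega))
      (hpe.block_mono le_rfl (by omega) (by omega) (by omega))
      (hpe.block_mono le_rfl (by omega) (by omega) (by omega))
      (hpe.block_mono le_rfl (by omega) (by omega) (by omega))
      (hpe.block_mono le_rfl (by omega) (by omega) (by omega))
    have e₁' := e₁.mono (W' := W) (Set.union_subset (Set.union_subset (Set.union_subset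
      (Set.union_subset
        ((block_subset_block (by omega) (by omega)).trans heW)
        ((block_subset_block (by omega) (by omega)).trans heW))
        ((block_subset_block (by omega) (by omega)).trans heW))
        ((block_subset_block (by omega) (by omega)).trans heW))
        ((block_subset_block (by omega) (by omega)).trans hqW))
    obtain ⟨l', m₂, t₂, e₂, hG₂, ht₂⟩ := ih (n - (k + l)) (by omega) (k + l) l m₁ rfl (by omega)
      (by omega) (hkc.trans_le' (by gcongr; omega))
      (fun x hx => (e₁'.eq_of_notMem hx).trans (hm' x hx))
      (by rw [hpF m' hm'] at hG₁; exact hG₁ hG)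
    have e₀ : Exec B W (.set 5 (fun ρ => min (ρ 4) (ρ 0 - ρ 4)))
        (frame 6 [n, p, q, e, k, l₀]) m' (frame 6 [n, p, q, e, k, l]) m' 0 := by
      have : min k (n - k) ≤ B := by omega
      rw [hl]
      exact .set_frame (by simp) this
    refine ⟨l', m₂, _, .loop_step hlt (.seq e₀ (.seq (.call ?_ e₁') (.set_frame (by simp) ?_))) e₂,
      hG₂, ?_⟩
    · simp only [List.forall_mem_cons, List.not_mem_nil, false_implies, implies_true, and_true]
      change p ≤ B ∧ q ≤ B ∧ k ≤ B ∧ l ≤ B ∧ e + d ≤ B ∧ e + d + l ≤ B ∧ e + d + l + l ≤ B ∧ e ≤ B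
      omega
    · change k + l ≤ B
      omega
    · rw [finalCost, dif_pos (by omega), ← hl]
      push_cast
      linarith
  -- both loops
  have hmain : ∀ N k m', n - k = N → 1 ≤ k → k ≤ n →
      (∀ x ∉ W, m' x = m x) → X ^ k ∣ polyAt m p n * polyAt m' q k - 1 →
      ∃ l' m'' t, Exec B W (.loop (fun ρ => 0 < ρ 5)
          (.call (newtonStep MP SP) [fun ρ => ρ 1, fun ρ => ρ 2, fun ρ => ρ 4, fun ρ => ρ 5,
              fun ρ => ρ 2 + ρ 0 - ρ 5, fun ρ => ρ 2 + ρ 4, fun ρ => ρ 2 + ρ 4 + ρ 5,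
              fun ρ => ρ 3] ;;
            .set 4 (fun ρ => ρ 4 + ρ 5) ;;
            .set 5 (fun ρ => stepLen c (ρ 0) (ρ 4))) ;;
          .loop (fun ρ => ρ 4 < ρ 0)
            (.set 5 (fun ρ => min (ρ 4) (ρ 0 - ρ 4)) ;;
              .call (newtonStep MP SP) [fun ρ => ρ 1, fun ρ => ρ 2, fun ρ => ρ 4, fun ρ => ρ 5,
                fun ρ => ρ 3 + d, fun ρ => ρ 3 + d + ρ 5, fun ρ => ρ 3 + d + ρ 5 + ρ 5,
                fun ρ => ρ 3] ;;
              .set 4 (fun ρ => ρ 4 + ρ 5)))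
          (frame 6 [n, p, q, e, k, stepLen c n k]) m' (frame 6 [n, p, q, e, n, l']) m'' t ∧
        X ^ n ∣ polyAt m p n * polyAt m'' q n - 1 ∧
        (t : ℝ) ≤ loopCost (stepCost A S) c n k := by
    intro N
    induction N using Nat.strong_induction_on with
    | _ N ih =>
    intro k m' hN hk hkn hm' hG
    rcases Nat.eq_zero_or_pos (stepLen c n k) with h0 | hpos
    · obtain ⟨l', m₂, t₂, e₂, hG₂, ht₂⟩ := hfinal _ k (stepLen c n k) m' rfl hk hkn
        (sub_lt_of_stepLen_eq_zero (by linarith) hk h0) hm' hG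
      refine ⟨l', m₂, _, .seq (.loop_done (Nat.not_lt.2 h0.le)) e₂, hG₂, ?_⟩
      rw [loopCost, dif_neg (by omega)]
      simpa using ht₂
    have hlk := stepLen_le c n k
    have hkln := add_stepLen_le (by linarith : 1 ≤ c) hkn
    have hcl := mul_stepLen_le (by linarith : 0 < c) n k
    have hlt := lt_of_stepLen_pos hpos
    obtain ⟨l, hl⟩ : ∃ l, l = stepLen c n k := ⟨_, rfl⟩
    rw [← hl] at hpos hlk hkln hcl ⊢
    -- Here c = 2 + max cm cs is used: result, auxiliary cells and work space together take at most
    -- c l ≤ n-k cells, so they lie disjointly in the free part of the output.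
    have hωl : ⌊max cm cs * l⌋₊ + 2 * l + k ≤ n := by
      have h1 : (⌊max cm cs * l⌋₊ : ℝ) ≤ max cm cs * l := Nat.floor_le (by positivity)
      have h2 : ((⌊max cm cs * l⌋₊ + 2 * l : ℕ) : ℝ) ≤ (n - k : ℕ) := by
        refine le_trans ?_ hcl
        rw [hc]
        push_cast
        linarith
      have := Nat.cast_le.1 h2
      omega
    obtain ⟨ρ₁, m₁, t₁, e₁, hG₁, ht₁⟩ := exists_exec_newtonStep hMP hSP (k := k) (l := l)
      (n := n) (B := B) (p := p) (q := q) (r := q + n - l) (a := q + k) (w := q + k + l) (e := e)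
      (ω := ⌊max cm cs * l⌋₊) (d := d) m' (by omega) (by omega) (by omega) (hωm l) (hωs l)
      (le_max_left _ _) (le_max_right _ _)
      (by omega) (by omega) (by omega) (by omega) (by omega) (by omega)
      (disjoint_block_of_le (by omega)).symm (disjoint_block_of_le (by omega)).symm
      (hqe.block_mono (by omega) (by omega) le_rfl (by omega)) (disjoint_block_of_le (by omega))
      (hqe.block_mono (by omega) (by omega) le_rfl (by omega))
      (hqe.block_mono (by omega) (by omega) le_rfl (by omega))
      (disjoint_block_of_le (by omega)) (disjoint_block_of_le (by omega))
      (disjoint_block_of_le (by omega)) (hqe.block_mono (by omega) (by omega) le_rfl (by omega))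
      (hpq.block_mono le_rfl (by omega) (by omega) (by omega))
      (hpq.block_mono le_rfl (by omega) (by omega) (by omega))
      (hpq.block_mono le_rfl (by omega) (by omega) (by omega))
      (hpe.block_mono le_rfl (by omega) (by omega) (by omega))
    have e₁' := e₁.mono (W' := W) (Set.union_subset (Set.union_subset (Set.union_subset
      (Set.union_subset
        ((block_subset_block (by omega) (by omega)).trans hqW)
        ((block_subset_block (by omega) (by omega)).trans hqW))
        ((block_subset_block (by omega) (by omega)).trans hqW))
        ((block_subset_block (by omega) (by omega)).trans heW))
        ((block_subset_block (by omega) (by omega)).trans hqW))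
    obtain ⟨l', m₂, t₂, e₂, hG₂, ht₂⟩ := ih (n - (k + l)) (by omega) (k + l) m₁ rfl (by omega)
      (by omega) (fun x hx => (e₁'.eq_of_notMem hx).trans (hm' x hx))
      (by rw [hpF m' hm'] at hG₁; exact hG₁ hG)
    -- The induction hypothesis runs both loops in sequence. It is split so that one more iteration
    -- can be put in front of the first loop.
    cases e₂ with
    | seq e₂ e₃ =>
    refine ⟨l', m₂, _, .seq (.loop_step hpos
      (.seq (.call ?_ e₁') (.seq (.set_frame (by simp) ?_) (.set_frame (by simp) ?_))) e₂) e₃,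
      hG₂, ?_⟩
    · simp only [List.forall_mem_cons, List.not_mem_nil, false_implies, implies_true, and_true]
      change p ≤ B ∧ q ≤ B ∧ k ≤ B ∧ l ≤ B ∧ q + n - l ≤ B ∧ q + k ≤ B ∧ q + k + l ≤ B ∧ e ≤ B
      omega
    · change k + l ≤ B
      omega
    · change stepLen c n (k + l) ≤ B
      have := add_stepLen_le (by linarith : 1 ≤ c) hkln
      omega
    · rw [loopCost, dif_pos (by omega), ← hl]
      push_cast at ht₂ ⊢
      linarith
  -- the initialization
  obtain ⟨y, hy⟩ := hu.exists_right_inv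
  have hqmem : q ∈ W := hqW ⟨le_rfl, by omega⟩
  obtain ⟨l', m₁, t₁, e₁, hG₁, ht₁⟩ := hmain _ 1 (Function.update m q y) rfl le_rfl hn
    (fun x hx => Function.update_of_ne (ne_of_mem_of_not_mem hqmem hx).symm _ _)
    (by
      rw [X_pow_dvd_iff]
      intro i hi
      obtain rfl : i = 0 := by omega
      simp [coeff_sub, mul_coeff_zero, coeff_polyAt, show 0 < n from hn, hy])
  have e₀ : Exec B W (.set 4 (fun _ => 1)) (frame 6 [n, p, q, e]) (Function.update m q y)
      (frame 6 [n, p, q, e, 1, 0]) (Function.update m q y) 0 := by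
    have h1 : 1 ≤ B := by omega
    rw [← frame_append_zero, ← frame_append_zero]
    exact .set_frame (by simp) h1
  have h2 : stepLen c n 1 ≤ B := by
    have := add_stepLen_le (by linarith : 1 ≤ c) hn
    omega
  have e₀' : Exec B W (.set 5 (fun ρ => stepLen c (ρ 0) (ρ 4))) (frame 6 [n, p, q, e, 1, 0])
      (Function.update m q y) (frame 6 [n, p, q, e, 1, stepLen c n 1])
      (Function.update m q y) 0 :=
    .set_frame (by simp) h2
  refine ⟨_, m₁, _, .seq (.inv hqmem hy) (.seq e₀ (.seq e₀' e₁)), hG₁, ?_⟩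
  push_cast
  linarith

end

/-! ### The accelerating and the decelerating phase -/

theorem one_le_knownCoeffs (c : ℝ) (n i : ℕ) : 1 ≤ knownCoeffs c n i := by
  induction i with
  | zero => exact le_rfl
  | succ i ih => exact ih.trans (Nat.le_add_right _ _)

theorem knownCoeffs_le {c : ℝ} (hc : 1 ≤ c) {n : ℕ} (hn : 1 ≤ n) (i : ℕ) :
    knownCoeffs c n i ≤ n := by
  induction i with
  | zero => exact hn
  | succ i ih => exact add_stepLen_le hc ih

theorem knownCoeffs_mono (c : ℝ) (n : ℕ) : Monotone (knownCoeffs c n) :=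
  monotone_nat_of_le_succ fun _ => Nat.le_add_right _ _

/-- Once the step length is less than `k`, it remains so for all larger `k`. -/
theorem stepLen_lt_of_le {c : ℝ} (hc : 0 ≤ c) {n k k' : ℕ} (h : stepLen c n k < k) (hk : k ≤ k') :
    stepLen c n k' < k' := by
  -- The condition l < k says ⌊(n-k)/c⌋ < k, whose left side decreases and whose right side
  -- increases with k.
  have h1 : ⌊((n - k' : ℕ) : ℝ) / c⌋₊ ≤ ⌊((n - k : ℕ) : ℝ) / c⌋₊ := by gcongr
  rw [stepLen] at *
  omega

/-- The condition l < k persists once it holds, so i₀ is the first index where it does. Such an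
index exists: steps with l = k forever would push k beyond n. -/
theorem exists_phases {c : ℝ} (hc : 1 ≤ c) {n : ℕ} (hn : 1 ≤ n) : ∃ i₀ : ℕ,
    (∀ i < i₀, stepLen c n (knownCoeffs c n i) = knownCoeffs c n i) ∧
    (∀ i ≥ i₀, stepLen c n (knownCoeffs c n i) < knownCoeffs c n i) := by
  classical
  have hex : ∃ i, stepLen c n (knownCoeffs c n i) < knownCoeffs c n i := by
    by_contra! h
    have hgrow : ∀ i, i + 1 ≤ knownCoeffs c n i := by
      intro i
      induction i with
      | zero => exact le_rfl
      | succ i ih =>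
        have h1 := h i
        have h2 := one_le_knownCoeffs c n i
        rw [knownCoeffs]
        omega
    have h1 := hgrow n
    have h2 := knownCoeffs_le hc hn n
    omega
  refine ⟨Nat.find hex, fun i hi => ?_, fun i hi => ?_⟩
  · exact (stepLen_le c n _).antisymm (not_lt.1 (Nat.find_min hex hi))
  · exact stepLen_lt_of_le (by linarith) (Nat.find_spec hex) (knownCoeffs_mono c n hi)

/-! ### The cost of the algorithm -/

theorem stepCost_nonneg {A S : ℕ → ℝ} (hA : ∀ n, 0 ≤ A n) (hS : ∀ n, 0 ≤ S n) (k l : ℕ) :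
    0 ≤ stepCost A S k l := by
  have := hA l
  have := hS l
  unfold stepCost
  positivity

theorem finalCost_nonneg {C : ℕ → ℕ → ℝ} (hC : ∀ k l, 0 ≤ C k l) (n k : ℕ) :
    0 ≤ finalCost C n k := by
  induction k using finalCost.induct n with
  | case1 k h ih => rw [finalCost, dif_pos h]; exact add_nonneg (hC _ _) ih
  | case2 k h => rw [finalCost, dif_neg h]

theorem loopCost_nonneg {C : ℕ → ℕ → ℝ} (hC : ∀ k l, 0 ≤ C k l) (c : ℝ) (n k : ℕ) :
    0 ≤ loopCost C c n k := by
  induction k using loopCost.induct c n with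
  | case1 k h ih => rw [loopCost, dif_pos h]; exact add_nonneg (hC _ _) ih
  | case2 k h => rw [loopCost, dif_neg h]; exact finalCost_nonneg hC n k

theorem natDiv_mul_le (k l : ℕ) : (((k - 1) / l : ℕ) : ℝ) * l ≤ k := by
  exact_mod_cast (Nat.div_mul_le_self _ _).trans (Nat.sub_le _ _)

/-- A bound for the cost of a step from `k` to `k + l` coefficients. -/
theorem stepCost_le {A S : ℕ → ℝ} {k l : ℕ} (hA : 0 ≤ A l) (hl : 1 ≤ l) :
    stepCost A S k l ≤ (k + l) / l * A l + k + l + S l := by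
  have hl' : (0 : ℝ) < l := by exact_mod_cast hl
  have h := natDiv_mul_le k l
  -- This is ⌈k/l⌉ ≤ (k+l)/l, a form to which superlinearity from l to k+l applies.
  have h1 : (((k - 1) / l + 1 : ℕ) : ℝ) ≤ (k + l) / l := by
    rw [le_div_iff₀ hl']
    push_cast
    linarith
  have := mul_le_mul_of_nonneg_right h1 hA
  unfold stepCost
  linarith

theorem stepCost_self {A S : ℕ → ℝ} {k : ℕ} (hk : 1 ≤ k) : stepCost A S k k = A k + k + S k := by
  rw [stepCost, Nat.div_eq_of_lt (by omega)]
  simp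

section

variable {M : ℕ → ℝ} {lm ls c : ℝ}

theorem mul_le_mul_of_superlinear
    (hM : ∀ (α : ℝ) (n n' : ℕ), 1 ≤ α → 1 ≤ n → (n' : ℝ) = α * n → α * M n ≤ M n')
    {a b : ℕ} (ha : 1 ≤ a) (hab : a ≤ b) : b / a * M a ≤ M b := by
  have ha' : (0 : ℝ) < a := by exact_mod_cast ha
  refine hM _ a b ?_ ha (by field_simp)
  rw [le_div_iff₀ ha', one_mul]
  exact_mod_cast hab

/-- M(n)/n is nondecreasing, so a product in size l can be charged to the l new coefficients at the
rate M(n)/n each; these charges telescope along the algorithm. -/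
theorem le_div_mul_of_superlinear
    (hM : ∀ (α : ℝ) (n n' : ℕ), 1 ≤ α → 1 ≤ n → (n' : ℝ) = α * n → α * M n ≤ M n')
    {a b : ℕ} (ha : 1 ≤ a) (hab : a ≤ b) : M a ≤ M b / b * a := by
  have h := mul_le_mul_of_superlinear hM ha hab
  have ha' : (0 : ℝ) < a := by exact_mod_cast ha
  have hb' : (0 : ℝ) < b := by exact_mod_cast ha.trans hab
  rw [div_mul_eq_mul_div, div_le_iff₀ ha'] at h
  rw [div_mul_eq_mul_div, le_div_iff₀ hb']
  linarith

theorem le_of_superlinear (hM_nonneg : ∀ n, 0 ≤ M n)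
    (hM : ∀ (α : ℝ) (n n' : ℕ), 1 ≤ α → 1 ≤ n → (n' : ℝ) = α * n → α * M n ≤ M n')
    {a b : ℕ} (ha : 1 ≤ a) (hab : a ≤ b) : M a ≤ M b := by
  have ha' : (0 : ℝ) < a := by exact_mod_cast ha
  refine le_trans ?_ (mul_le_mul_of_superlinear hM ha hab)
  refine le_mul_of_one_le_left (hM_nonneg a) ?_
  rw [le_div_iff₀ ha', one_mul]
  exact_mod_cast hab

/-- A bound for the cost of the last loop. -/
theorem finalCost_le (hM_nonneg : ∀ n, 0 ≤ M n)
    (hM : ∀ (α : ℝ) (n n' : ℕ), 1 ≤ α → 1 ≤ n → (n' : ℝ) = α * n → α * M n ≤ M n')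
    (hlm : 0 ≤ lm) (hls : 0 ≤ ls) {n k : ℕ} (hkn : k ≤ n) (hk : n - k ≤ k) :
    finalCost (stepCost (fun n => lm * M n) (fun n => ls * M n)) n k ≤
      lm * M n + n + ((n - k : ℕ) + ls * (M n / n * (n - k : ℕ))) := by
  have hMn := hM_nonneg n
  rcases hkn.eq_or_lt with rfl | hlt
  · rw [finalCost, dif_neg (by omega)]
    positivity
  obtain ⟨l, rfl⟩ := Nat.exists_eq_add_of_le hkn
  rw [Nat.add_sub_cancel_left] at hk ⊢
  have h1 := stepCost_le (A := fun n => lm * M n) (S := fun n => ls * M n) (k := k) (mul_nonneg hlm (hM_nonneg l))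
    (by omega : 1 ≤ l)
  have h2 := mul_le_mul_of_superlinear hM (by omega : 1 ≤ l) (Nat.le_add_left l k)
  have h3 := le_div_mul_of_superlinear hM (by omega : 1 ≤ l) (Nat.le_add_left l k)
  have h2' := mul_le_mul_of_nonneg_left h2 hlm
  have h3' := mul_le_mul_of_nonneg_left h3 hls
  have hl : (0 : ℝ) ≤ l := Nat.cast_nonneg l
  -- Since n-k ≤ k, one step computes everything that is missing.
  rw [finalCost, dif_pos (by omega), Nat.add_sub_cancel_left, min_eq_right hk, finalCost,
    dif_neg (by omega)]
  push_cast at h2' h3' ⊢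
  linarith

/-- A bound for the cost of the algorithm by potentials `Θ` for the middle products and `Ψ` for the
number of steps of the decelerating phase, as functions of the number of missing coefficients. -/
theorem loopCost_le (hM_nonneg : ∀ n, 0 ≤ M n)
    (hM : ∀ (α : ℝ) (n n' : ℕ), 1 ≤ α → 1 ≤ n → (n' : ℝ) = α * n → α * M n ≤ M n')
    (hlm : 0 ≤ lm) (hls : 0 ≤ ls) (hc : 1 ≤ c) {n : ℕ} (hn : 2 * c ≤ n) {Θ Ψ : ℕ → ℝ}
    (hΘ : Monotone Θ) (hΨ : Monotone Ψ) (hΘ0 : ∀ r, 0 ≤ Θ r) (hΨ0 : ∀ r, 0 ≤ Ψ r)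
    (hΘstep : ∀ k, k ≤ n → 0 < stepLen c n k → stepLen c n k < k →
      ((k + stepLen c n k : ℕ) : ℝ) / (stepLen c n k) * M (stepLen c n k) +
        Θ (n - (k + stepLen c n k)) ≤ Θ (n - k))
    (hΨstep : ∀ k, k ≤ n → 0 < stepLen c n k → stepLen c n k < k →
      1 + Ψ (n - (k + stepLen c n k)) ≤ Ψ (n - k))
    {k : ℕ} (hk : 1 ≤ k) (hkn : k ≤ n) :
    loopCost (stepCost (fun n => lm * M n) (fun n => ls * M n)) c n k ≤
      lm * Θ (n - k) + n * Ψ (n - k) + (lm + ls) * (M n / n * (n - k : ℕ)) + (n - k : ℕ) +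
        lm * M n + n := by
  have hMn := hM_nonneg n
  induction k using loopCost.induct c n with
  | case2 k h =>
    rw [loopCost, dif_neg h]
    have h0 : ((n - k : ℕ) : ℝ) < c := sub_lt_of_stepLen_eq_zero (by linarith) hk (by omega)
    -- Fewer than c ≤ n/2 coefficients are missing, so at least half are known.
    have h1 : n - k ≤ k := by
      have : (k : ℝ) + (n - k : ℕ) = n := by exact_mod_cast Nat.add_sub_cancel' hkn
      have : ((n - k : ℕ) : ℝ) ≤ k := by linarith
      exact_mod_cast this
    refine (finalCost_le hM_nonneg hM hlm hls hkn h1).trans ?_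
    have e1 : 0 ≤ lm * Θ (n - k) := mul_nonneg hlm (hΘ0 _)
    have e2 : 0 ≤ n * Ψ (n - k) := mul_nonneg (Nat.cast_nonneg _) (hΨ0 _)
    have e3 : 0 ≤ lm * (M n / n * (n - k : ℕ)) := by positivity
    linarith
  | case1 k h ih =>
    have hkl := add_stepLen_le hc hkn
    have ih := ih (by omega) hkl
    rw [loopCost, dif_pos h]
    have hlk := stepLen_le c n k
    have hΘs := hΘstep k hkn h
    have hΨs := hΨstep k hkn h
    obtain ⟨l, hl⟩ : ∃ l, l = stepLen c n k := ⟨_, rfl⟩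
    rw [← hl] at h hkl ih hlk hΘs hΨs ⊢
    have hr : ((n - k : ℕ) : ℝ) = (n - (k + l) : ℕ) + l := by
      have : n - k = n - (k + l) + l := by omega
      exact_mod_cast this
    have hMl := le_div_mul_of_superlinear hM h ((Nat.le_add_left l k).trans hkl)
    have hls' := mul_le_mul_of_nonneg_left hMl hls
    have hlm' := mul_le_mul_of_nonneg_left hMl hlm
    have hlm0 : 0 ≤ lm * (M n / n * l) := by positivity
    have hn0 : (0 : ℝ) ≤ n := Nat.cast_nonneg n
    rw [hr]
    rcases hlk.eq_or_lt with rfl | hlt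
    -- An accelerating step has a single middle product, paid at the rate M(n)/n; of the potentials
    -- only monotonicity is needed.
    · rw [stepCost_self hk]
      have e1 := mul_le_mul_of_nonneg_left (hΘ (by omega : n - (l + l) ≤ n - l)) hlm
      have e2 := mul_le_mul_of_nonneg_left (hΨ (by omega : n - (l + l) ≤ n - l)) hn0
      linarith
    -- In a decelerating step Θ pays for the middle products, and the unit drop of Ψ pays for the k
    -- ≤ n additional operations.
    · have h1 := stepCost_le (A := fun n => lm * M n) (S := fun n => ls * M n) (k := k) (mul_nonneg hlm (hM_nonneg l)) h
      have e1 := mul_le_mul_of_nonneg_left (hΘs hlt) hlm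
      have e2 := mul_le_mul_of_nonneg_left (hΨs hlt) hn0
      have e3 : (k : ℝ) ≤ n := by exact_mod_cast hkn
      push_cast at e1
      linarith

/-! ### Potentials -/

theorem div_lt_stepLen_add_one {n k : ℕ} (hlt : stepLen c n k < k) :
    ((n - k : ℕ) : ℝ) / c < stepLen c n k + 1 := by
  have : stepLen c n k = ⌊((n - k : ℕ) : ℝ) / c⌋₊ := by
    rw [stepLen] at hlt ⊢
    omega
  rw [this]
  exact Nat.lt_floor_add_one _

/-- A bound for the number of steps of the decelerating phase when `r` coefficients are missing. -/
noncomputable def stepCount (c r : ℝ) : ℝ :=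
  Real.logb (c / (c - 1)) (max 1 (r - c)) + min 3 (max 0 (r - c + 1))

theorem one_lt_div_sub_one (hc : 1 < c) : 1 < c / (c - 1) := by
  rw [lt_div_iff₀ (by linarith)]
  linarith

theorem stepCount_mono (hc : 1 < c) : Monotone (stepCount c) := by
  intro r r' h
  refine add_le_add ?_ ?_
  · refine Real.logb_le_logb_of_le (one_lt_div_sub_one hc) (by positivity) ?_
    gcongr
  · gcongr

theorem stepCount_nonneg (hc : 1 < c) (r : ℝ) : 0 ≤ stepCount c r :=
  add_nonneg (Real.logb_nonneg (one_lt_div_sub_one hc) (le_max_left _ _)) (by positivity)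

theorem stepCount_le (hc : 1 < c) {r x : ℝ} (hx : 1 ≤ x) (hr : r ≤ x) :
    stepCount c r ≤ Real.logb (c / (c - 1)) x + 3 := by
  refine add_le_add ?_ (min_le_left _ _)
  exact Real.logb_le_logb_of_le (one_lt_div_sub_one hc) (by positivity)
    (max_le hx (by linarith))

/-- The map r ↦ r - r/c + 1 fixes c and contracts towards it by (c-1)/c, and r-l lies below its
value at r. So the logarithm of r-c drops by 1, except near c, where the second summand of
`stepCount` drops by 1 because l ≥ 1. -/
theorem one_add_stepCount_le (hc : 2 ≤ c) {r l : ℝ} (hl : 1 ≤ l) (hlr : c * l ≤ r)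
    (hrl : r / c < l + 1) : 1 + stepCount c (r - l) ≤ stepCount c r := by
  have hb := one_lt_div_sub_one (by linarith : 1 < c)
  have hcr : c ≤ r := by nlinarith
  have hmono : Real.logb (c / (c - 1)) (max 1 (r - l - c)) ≤
      Real.logb (c / (c - 1)) (max 1 (r - c)) :=
    Real.logb_le_logb_of_le hb (by positivity) (max_le_max le_rfl (by linarith))
  -- If r-c ≥ 2, then (r-c)(c-1)/c ≥ 1 because c ≥ 2, so the cutoff at 1 does no harm. If r-c < 2,
  -- the cap 3 is inactive.
  rcases le_or_gt (c + 2) r with h | h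
  · have h1 : max 1 (r - l - c) ≤ (r - c) / (c / (c - 1)) := by
      rw [div_div_eq_mul_div, le_div_iff₀ (by linarith)]
      rw [div_lt_iff₀ (by linarith)] at hrl
      rcases max_cases 1 (r - l - c) with ⟨he, _⟩ | ⟨he, _⟩ <;> rw [he]
      · nlinarith
      · nlinarith
    have h2 : Real.logb (c / (c - 1)) (max 1 (r - l - c)) ≤
        Real.logb (c / (c - 1)) (r - c) - 1 := by
      refine (Real.logb_le_logb_of_le hb (by positivity) h1).trans_eq ?_
      rw [Real.logb_div (by linarith) (by linarith), Real.logb_self_eq_one hb]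
    have h3 : min 3 (max 0 (r - l - c + 1)) ≤ min 3 (max 0 (r - c + 1)) := by
      gcongr
      linarith
    rw [stepCount, stepCount, max_eq_right (by linarith : 1 ≤ r - c)]
    linarith
  · have h3 : 1 + min 3 (max 0 (r - l - c + 1)) ≤ min 3 (max 0 (r - c + 1)) := by
      rw [max_eq_right (by linarith : 0 ≤ r - c + 1), min_eq_right (by linarith : r - c + 1 ≤ 3)]
      have : max 0 (r - l - c + 1) ≤ r - c := max_le (by linarith) (by linarith)
      linarith [min_le_right 3 (max 0 (r - l - c + 1))]
    unfold stepCount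
    linarith

theorem cast_sub_add {n k l : ℕ} (h : k + l ≤ n) :
    ((n - (k + l) : ℕ) : ℝ) = (n - k : ℕ) - l := by
  rw [eq_sub_iff_add_eq]
  exact_mod_cast (by omega : n - (k + l) + l = n - k)

theorem one_add_stepCount_stepLen_le (hc : 2 ≤ c) {n k : ℕ} (hkn : k ≤ n)
    (hpos : 0 < stepLen c n k) (hlt : stepLen c n k < k) :
    1 + stepCount c (n - (k + stepLen c n k) : ℕ) ≤ stepCount c (n - k : ℕ) := by
  rw [cast_sub_add (add_stepLen_le (by linarith) hkn)]
  exact one_add_stepCount_le hc (by exact_mod_cast hpos) (mul_stepLen_le (by linarith) n k)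
    (div_lt_stepLen_add_one hlt)

/-- The cost of the algorithm if a potential `Θ` for the middle products is given. -/
theorem loopCost_one_le (hM_nonneg : ∀ n, 0 ≤ M n)
    (hM : ∀ (α : ℝ) (n n' : ℕ), 1 ≤ α → 1 ≤ n → (n' : ℝ) = α * n → α * M n ≤ M n')
    (hlm : 0 ≤ lm) (hls : 0 ≤ ls) (hc : 2 ≤ c) {n : ℕ} (hn : 2 * c ≤ n) {Θ : ℕ → ℝ}
    (hΘ : Monotone Θ) (hΘ0 : ∀ r, 0 ≤ Θ r)
    (hΘstep : ∀ k, k ≤ n → 0 < stepLen c n k → stepLen c n k < k →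
      ((k + stepLen c n k : ℕ) : ℝ) / (stepLen c n k) * M (stepLen c n k) +
        Θ (n - (k + stepLen c n k)) ≤ Θ (n - k)) :
    loopCost (stepCost (fun n => lm * M n) (fun n => ls * M n)) c n 1 ≤
      lm * Θ n + n * (Real.logb (c / (c - 1)) n + 5) + (2 * lm + ls) * M n := by
  have hn1 : (1 : ℝ) ≤ n := by linarith
  have hn1' : 1 ≤ n := by exact_mod_cast hn1
  have h := loopCost_le hM_nonneg hM hlm hls (by linarith) hn (Ψ := fun r => stepCount c r) hΘ
    (fun r r' h => stepCount_mono (by linarith) (Nat.cast_le.2 h)) hΘ0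
    (fun r => stepCount_nonneg (by linarith) r) hΘstep
    (fun k => one_add_stepCount_stepLen_le hc) le_rfl hn1'
  refine h.trans ?_
  have hr : ((n - 1 : ℕ) : ℝ) ≤ n := by exact_mod_cast Nat.sub_le n 1
  have hMn := hM_nonneg n
  have e1 := mul_le_mul_of_nonneg_left (hΘ (Nat.sub_le n 1)) hlm
  have e2 := mul_le_mul_of_nonneg_left (stepCount_le (by linarith : 1 < c) hn1 hr)
    (by linarith : (0 : ℝ) ≤ n)
  have e3 : M n / n * (n - 1 : ℕ) ≤ M n := by
    rw [div_mul_eq_mul_div, div_le_iff₀ (by linarith)]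
    gcongr
  have e4 := mul_le_mul_of_nonneg_left e3 (by linarith : 0 ≤ lm + ls)
  linarith

/-- The cost of the algorithm for arbitrary `M`. -/
theorem loopCost_one_le_logb (hM_nonneg : ∀ n, 0 ≤ M n)
    (hM : ∀ (α : ℝ) (n n' : ℕ), 1 ≤ α → 1 ≤ n → (n' : ℝ) = α * n → α * M n ≤ M n')
    (hlm : 0 ≤ lm) (hls : 0 ≤ ls) (hc : 2 ≤ c) {n : ℕ} (hn : 2 * c ≤ n) :
    loopCost (stepCost (fun n => lm * M n) (fun n => ls * M n)) c n 1 ≤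
      lm * M n * Real.logb (c / (c - 1)) n + n * (Real.logb (c / (c - 1)) n + 5) +
        (5 * lm + ls) * M n := by
  have hMn := hM_nonneg n
  have hn1 : (1 : ℝ) ≤ n := by linarith
  -- Every decelerating step is charged M(n), so Θ is M(n) times the step count.
  have h := loopCost_one_le hM_nonneg hM hlm hls hc hn (Θ := fun r => M n * stepCount c r)
    (fun r r' h =>
      mul_le_mul_of_nonneg_left (stepCount_mono (by linarith) (Nat.cast_le.2 h)) hMn)
    (fun r => mul_nonneg hMn (stepCount_nonneg (by linarith) r))
    (by
      intro k hkn hpos hlt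
      have h1 := one_add_stepCount_stepLen_le hc hkn hpos hlt
      have h2 := mul_le_mul_of_superlinear hM hpos (Nat.le_add_left (stepLen c n k) k)
      have h3 := le_of_superlinear hM_nonneg hM (by omega)
        (add_stepLen_le (by linarith : 1 ≤ c) hkn)
      have h4 := mul_le_mul_of_nonneg_left h1 hMn
      linarith)
  have h5 := mul_le_mul_of_nonneg_left (stepCount_le (by linarith : 1 < c) hn1 le_rfl)
    (mul_nonneg hlm hMn)
  linarith

/-- The lengths of the steps of the decelerating phase decrease geometrically. -/
theorem rpow_add_rpow_le (hc : 1 ≤ c) {γ : ℝ} (hγ : 0 < γ) {r l : ℝ} (hl : 1 ≤ l)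
    (hlr : c * l ≤ r) (hrl : r / c < l + 1) :
    l ^ γ + (1 - (1 - 1 / (2 * c)) ^ γ)⁻¹ * (r - l) ^ γ ≤
      (1 - (1 - 1 / (2 * c)) ^ γ)⁻¹ * r ^ γ := by
  have hβ : 1 / (2 * c) ≤ 1 := by rw [div_le_iff₀ (by linarith)]; linarith
  have hβ0 : 0 < 1 / (2 * c) := by positivity
  have hlr' : l ≤ r := by nlinarith
  have hD : 0 < 1 - (1 - 1 / (2 * c)) ^ γ :=
    sub_pos.2 (Real.rpow_lt_one (by linarith) (by linarith) hγ)
  have h1 : (r - l) ^ γ ≤ (1 - 1 / (2 * c)) ^ γ * r ^ γ := by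
    rw [← Real.mul_rpow (by linarith) (by linarith)]
    refine Real.rpow_le_rpow (by linarith) ?_ hγ.le
    -- From l ≥ 1 one gets r < c(l+1) ≤ 2cl: at least the fraction 1/(2c) of the missing
    -- coefficients is computed. The constant in front of r^γ is the sum of the resulting geometric
    -- series.
    have : 1 / (2 * c) * r ≤ l := by
      rw [one_div_mul_eq_div, div_le_iff₀ (by linarith)]
      rw [div_lt_iff₀ (by linarith)] at hrl
      nlinarith
    linarith
  have h2 : l ^ γ ≤ r ^ γ := Real.rpow_le_rpow (by linarith) hlr' hγ.le
  rw [inv_mul_eq_div, inv_mul_eq_div, ← le_sub_iff_add_le, ← sub_div, le_div_iff₀ hD]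
  have := mul_le_mul_of_nonneg_right h2 hD.le
  linarith

/-- The cost of the algorithm if `M n = n ^ (1 + γ)`. -/
theorem loopCost_one_le_rpow (hM_nonneg : ∀ n, 0 ≤ M n)
    (hM : ∀ (α : ℝ) (n n' : ℕ), 1 ≤ α → 1 ≤ n → (n' : ℝ) = α * n → α * M n ≤ M n')
    (hlm : 0 ≤ lm) (hls : 0 ≤ ls) (hc : 2 ≤ c) {γ : ℝ} (hγ : 0 < γ)
    (hMγ : ∀ n : ℕ, 1 ≤ n → M n = (n : ℝ) ^ (1 + γ)) {n : ℕ} (hn : 2 * c ≤ n) :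
    loopCost (stepCost (fun n => lm * M n) (fun n => ls * M n)) c n 1 ≤
      n * (Real.logb (c / (c - 1)) n + 5) +
        (lm * (1 - (1 - 1 / (2 * c)) ^ γ)⁻¹ + 2 * lm + ls) * M n := by
  have hn1 : (1 : ℝ) ≤ n := by linarith
  set D := (1 - (1 - 1 / (2 * c)) ^ γ)⁻¹ with hD
  have hD0 : 0 ≤ D := by
    have hβ : 1 / (2 * c) ≤ 1 := by rw [div_le_iff₀ (by linarith)]; linarith
    have hβ0 : 0 < 1 / (2 * c) := by positivity
    exact inv_nonneg.2 (sub_nonneg.2 (Real.rpow_le_one (by linarith) (by linarith) hγ.le))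
  -- The middle products cost (k+l)/l · l^(1+γ) ≤ n l^γ, which explains the factor n in Θ.
  have h := loopCost_one_le hM_nonneg hM hlm hls hc hn (Θ := fun r => n * (D * (r : ℝ) ^ γ))
    (fun r r' h => by dsimp only; gcongr) (fun r => by positivity)
    (by
      intro k hkn hpos hlt
      have hkl := add_stepLen_le (by linarith : 1 ≤ c) hkn
      have hl1 : (1 : ℝ) ≤ stepLen c n k := by exact_mod_cast hpos
      have h1 := rpow_add_rpow_le (by linarith : 1 ≤ c) hγ hl1
        (mul_stepLen_le (by linarith) n k) (div_lt_stepLen_add_one hlt)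
      rw [cast_sub_add hkl, hMγ _ hpos, Real.rpow_add (by linarith), Real.rpow_one, ← mul_assoc,
        div_mul_cancel₀ _ (by linarith)]
      have h2 : ((k + stepLen c n k : ℕ) : ℝ) * (stepLen c n k : ℝ) ^ γ ≤
          n * (stepLen c n k : ℝ) ^ γ := by
        gcongr
      have h3 := mul_le_mul_of_nonneg_left h1 (by linarith : (0 : ℝ) ≤ n)
      linarith)
  have h1 : M n = n * (n : ℝ) ^ γ := by
    rw [hMγ n (by exact_mod_cast hn1), Real.rpow_add (by linarith), Real.rpow_one]
  refine h.trans (le_of_eq ?_)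
  rw [h1]
  ring

end

/-! ### Asymptotics -/

theorem exists_loopCost_le_of_isBigO {M : ℕ → ℝ} (hM_nonneg : ∀ n, 0 ≤ M n)
    (hM : ∀ (α : ℝ) (n n' : ℕ), 1 ≤ α → 1 ≤ n → (n' : ℝ) = α * n → α * M n ≤ M n')
    {lm ls c : ℝ} (hlm : 0 ≤ lm) (hls : 0 ≤ ls) (hc : 2 ≤ c)
    (hlog : (fun n : ℕ => (n : ℝ) * Real.log n) =O[atTop] M) :
    ∃ A : ℝ, ∀ᶠ n : ℕ in atTop,
      1 + loopCost (stepCost (fun n => lm * M n) (fun n => ls * M n)) c n 1 ≤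
        lm * M n * Real.logb (c / (c - 1)) n + A * M n := by
  obtain ⟨a, ha⟩ := hlog.bound
  have hb : 0 < Real.log (c / (c - 1)) := Real.log_pos (one_lt_div_sub_one (by linarith))
  -- The term 6a absorbs 5n and the initial inversion, by 1 ≤ n ≤ n log n ≤ a M(n); here log n ≥ 1
  -- because n ≥ 2c ≥ 4.
  refine ⟨(Real.log (c / (c - 1)))⁻¹ * a + 6 * a + (5 * lm + ls), ?_⟩
  filter_upwards [ha, eventually_ge_atTop ⌈2 * c⌉₊] with n hn hnc
  have hnc : 2 * c ≤ n := Nat.ceil_le.1 hnc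
  have hlog1 : 1 ≤ Real.log n := by
    rw [Real.le_log_iff_exp_le (by linarith)]
    linarith [Real.exp_one_lt_d9]
  have h := loopCost_one_le_logb hM_nonneg hM hlm hls hc hnc
  rw [Real.norm_of_nonneg (by positivity), Real.norm_of_nonneg (hM_nonneg n)] at hn
  have h1 : n * Real.logb (c / (c - 1)) n ≤ (Real.log (c / (c - 1)))⁻¹ * (a * M n) := by
    rw [Real.logb, div_eq_inv_mul, mul_left_comm]
    exact mul_le_mul_of_nonneg_left hn (inv_nonneg.2 hb.le)
  have h2 : (n : ℝ) ≤ a * M n := (le_mul_of_one_le_right (by positivity) hlog1).trans hn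
  linarith

/-- The bound log n ≤ n^γ/γ makes the linear work, O(n log n), part of O(n^(1+γ)). -/
theorem loopCost_isBigO_of_eq_rpow {M : ℕ → ℝ} (hM_nonneg : ∀ n, 0 ≤ M n)
    (hM : ∀ (α : ℝ) (n n' : ℕ), 1 ≤ α → 1 ≤ n → (n' : ℝ) = α * n → α * M n ≤ M n')
    {lm ls c : ℝ} (hlm : 0 ≤ lm) (hls : 0 ≤ ls) (hc : 2 ≤ c) {γ : ℝ} (hγ : 0 < γ)
    (hMγ : ∀ n : ℕ, 1 ≤ n → M n = (n : ℝ) ^ (1 + γ)) :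
    (fun n => 1 + loopCost (stepCost (fun n => lm * M n) (fun n => ls * M n)) c n 1) =O[atTop]
      M := by
  have hb : 0 < Real.log (c / (c - 1)) := Real.log_pos (one_lt_div_sub_one (by linarith))
  refine IsBigO.of_bound ((Real.log (c / (c - 1)))⁻¹ * γ⁻¹ + 6 +
    (lm * (1 - (1 - 1 / (2 * c)) ^ γ)⁻¹ + 2 * lm + ls)) ?_
  filter_upwards [eventually_ge_atTop ⌈2 * c⌉₊] with n hnc
  have hnc : 2 * c ≤ n := Nat.ceil_le.1 hnc
  have h := loopCost_one_le_rpow hM_nonneg hM hlm hls hc hγ hMγ hnc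
  have h0 := loopCost_nonneg (stepCost_nonneg (fun n => mul_nonneg hlm (hM_nonneg n))
    (fun n => mul_nonneg hls (hM_nonneg n))) c n 1
  have hMn : M n = n * (n : ℝ) ^ γ := by
    rw [hMγ n (by exact_mod_cast (by linarith : (1 : ℝ) ≤ n)), Real.rpow_add (by linarith),
      Real.rpow_one]
  have h1 : n * Real.logb (c / (c - 1)) n ≤ (Real.log (c / (c - 1)))⁻¹ * (γ⁻¹ * M n) := by
    rw [Real.logb, div_eq_inv_mul, mul_left_comm, hMn, mul_left_comm γ⁻¹]
    refine mul_le_mul_of_nonneg_left (mul_le_mul_of_nonneg_left ?_ (by positivity))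
      (inv_nonneg.2 hb.le)
    rw [inv_mul_eq_div]
    exact Real.log_le_rpow_div (by positivity) hγ
  have h2 : (n : ℝ) ≤ M n := by
    rw [hMn]
    exact le_mul_of_one_le_right (by positivity) (Real.one_le_rpow (by linarith) hγ.le)
  rw [Real.norm_of_nonneg (by positivity), Real.norm_of_nonneg (hM_nonneg n)]
  linarith

theorem mainTheorem1 {K : Type*} [CommRing K]
    -- the bound `M` for multiplication in size `n`: `α M(n) ≤ M(α n)` for `α ≥ 1`
    (M : ℕ → ℝ) (hM_nonneg : ∀ n, 0 ≤ M n)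
    (hM : ∀ (α : ℝ) (n n' : ℕ), 1 ≤ α → 1 ≤ n → (n' : ℝ) = α * n → α * M n ≤ M n')
    (lm ls cm cs : ℝ) (hlm : 0 ≤ lm) (hls : 0 ≤ ls) (hcm : 0 ≤ cm) (hcs : 0 ≤ cs) (dm ds : ℕ)
    (MP SP : Proc K)
    (hMP : MP.IsMiddleProduct (fun n => lm * M n) cm dm)
    (hSP : SP.IsShortProduct (fun n => ls * M n) cs ds)
    (c : ℝ) (hc : c = 2 + max cm cs) :
    -- an accelerating phase (`ℓ = k`) is followed by a decelerating phase (`ℓ < k`)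
    (∀ n : ℕ, 1 ≤ n → ∃ i₀ : ℕ,
      (∀ i < i₀, stepLen c n (knownCoeffs c n i) = knownCoeffs c n i) ∧
      (∀ i ≥ i₀, stepLen c n (knownCoeffs c n i) < knownCoeffs c n i)) ∧
    ∃ (S : ℕ) (T : ℕ → ℝ),
      -- correctness, with extra space `S = O(1)` and `T n` operations in `K`
      (∀ n : ℕ, 1 ≤ n → (inPlaceInv MP SP c (max dm ds)).InvertsWithin S n (T n)) ∧
      -- the case that `M` is quasi-linear
      ((fun n : ℕ => (n : ℝ) * Real.log n) =O[atTop] M →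
        (∃ κ : ℕ, M =O[atTop] fun n : ℕ => (n : ℝ) * Real.log n ^ κ) →
        (∃ A : ℝ, ∀ᶠ n : ℕ in atTop,
          T n ≤ lm * M n * Real.logb (c / (c - 1)) n + A * M n) ∧
        (cs ≤ cm → ∃ A : ℝ, ∀ᶠ n : ℕ in atTop,
          T n ≤ lm * M n * Real.logb ((cm + 2) / (cm + 1)) n + A * M n)) ∧
      -- the case `M(n) = n ^ (1 + γ)`
      (∀ γ : ℝ, 0 < γ → γ ≤ 1 → (∀ n : ℕ, 1 ≤ n → M n = (n : ℝ) ^ (1 + γ)) →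
        T =O[atTop] M) := by
  have hc2 : 2 ≤ c := by linarith [hcm.trans (le_max_left cm cs)]
  -- Unification with `inPlaceInv_invertsWithin` supplies S, which does not depend on n, and T(n) =
  -- 1 + `loopCost`, where 1 counts the inversion of the constant coefficient.
  refine ⟨fun n hn => exists_phases (by linarith) hn, _, _,
    fun n hn => inPlaceInv_invertsWithin hMP hSP hcm hc hn, fun hlog _ => ⟨?_, fun hle => ?_⟩,
    fun γ hγ _ hMγ => ?_⟩
  · exact exists_loopCost_le_of_isBigO hM_nonneg hM hlm hls hc2 hlog
  · rw [show cm + 2 = c by rw [hc, max_eq_left hle, add_comm],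
      show cm + 1 = c - 1 by rw [hc, max_eq_left hle]; ring]
    exact exists_loopCost_le_of_isBigO hM_nonneg hM hlm hls hc2 hlog
  · exact loopCost_isBigO_of_eq_rpow hM_nonneg hM hlm hls hc2 hγ hMγ
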